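/- Let $\beta>0$, $P>0$, $d>2$ be constants, and let $K_a(n)$ be integers with $K_a(n)/n\to\beta$ (for instance $K_a(n)=\lfloor\beta n\rfloor$; $K_a(n)=\beta n$ up to rounding). For each blocklength $n$ let $M_n=\lfloor n^d\rfloor$, and let the shared codebook consist of $x_m=\sqrt{nP}\,X_m/\|X_m\|$, $m\in\{1,\dots,M_n\}$, with $X_1,\dots,X_{M_n}$ i.i.d. $\mathcal N(0,I_n)$ (so the $x_m$ are independent and uniform on the sphere of radius $\sqrt{nP}$ in $\mathbb R^n$). Let $\mathcal S_n\subset\{1,\dots,M_n\}$ be the transmitted subset, with $|\mathcal S_n|=K_a(n)$ (assumed for all sufficiently large $n$); it may be deterministic, or random with any law, and is independent of the codebook and the noise. The channel output is $$Y=\sum_{m\in\mathcal S_n}x_m+Z,\qquad Z\sim\mathcal N(0,I_n)\ \text{independent of the codebook},$$ and $\hat u=Y/\|Y\|$. Let $u=u_n\in\mathbb R^n$ be a fixed (deterministic) unit vector, the true hemisphere axis, and let $$E_n=\{\langle x_m,u\rangle\ge 0\ \text{for all } m\in\mathcal S_n\}$$ be the event that all transmitted codewords lie in the hemisphere with axis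 $u$. Then $\mathbb P(E_n)>0$ for all sufficiently large $n$ and, conditionally on $E_n$, $$\langle u,\hat u\rangle\ \xrightarrow{P}\ c=\sqrt{\frac{2\beta}{2\beta+\pi}},$$ that is, $\mathbb P\bigl(|\langle u,\hat u\rangle-c|\ge\varepsilon \,\big|\, E_n\bigr)\to 0$ as $n\to\infty$ for every $\varepsilon>0$. -/

import Mathlib

open MeasureTheory ProbabilityTheory Filter Topology

/-- The codeword generated by the Gaussian vector `g`: its radial projection `√(nP) • g / ‖g‖` onto
the sphere of radius `√(nP)` in `ℝⁿ`. -/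
noncomputable def sphericalCodeword {n : ℕ} (P : ℝ) (g : EuclideanSpace ℝ (Fin n)) :
    EuclideanSpace ℝ (Fin n) :=
  Real.sqrt (n * P) • (‖g‖⁻¹ • g)

/-- The output `Y = ∑_{m ∈ S} x_m + Z` of the Gaussian multiple access channel, where `x_m` is the
codeword generated by `g m`, `S` is the transmitted subset and `z` is the noise. -/
noncomputable def channelOutput {n M : ℕ} (P : ℝ) (g : Fin M → EuclideanSpace ℝ (Fin n))
    (S : Finset (Fin M)) (z : EuclideanSpace ℝ (Fin n)) : EuclideanSpace ℝ (Fin n) :=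
  ∑ m ∈ S, sphericalCodeword P (g m) + z

/-- The normalized vector `y / ‖y‖`. -/
noncomputable def normalizedDirection {n : ℕ} (y : EuclideanSpace ℝ (Fin n)) :
    EuclideanSpace ℝ (Fin n) :=
  ‖y‖⁻¹ • y

/-- The closed hemisphere of the unit sphere of `ℝⁿ` with axis `u`. -/
def unitHemisphere {n : ℕ} (u : EuclideanSpace ℝ (Fin n)) : Set (EuclideanSpace ℝ (Fin n)) :=
  {s | s ∈ Metric.sphere (0 : EuclideanSpace ℝ (Fin n)) 1 ∧ 0 ≤ inner ℝ s u}

/-- The event that every transmitted codeword, normalized to the unit sphere, lies in the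
hemisphere with axis `u`. -/
def transmittedInHemisphere {n M : ℕ} {Ω : Type*} (P : ℝ)
    (X : Fin M → Ω → EuclideanSpace ℝ (Fin n)) (S : Ω → Finset (Fin M))
    (u : EuclideanSpace ℝ (Fin n)) : Set Ω :=
  {ω | ∀ m ∈ S ω, (Real.sqrt (n * P))⁻¹ • sphericalCodeword P (X m ω) ∈ unitHemisphere u}

/-- The many-access model at blocklength `n` with `M` messages and `K` active users: the vectors
`X m` generating the codebook are independent standard Gaussian vectors in `ℝⁿ`, the noise `Z` is a
standard Gaussian vector independent of them, and the transmitted set `S` of `K` messages (fixed, or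
random with any law) is independent of the codebook and the noise. -/
structure IsManyAccessModel {n M : ℕ} (K : ℕ) {Ω : Type*} [MeasurableSpace Ω] (μ : Measure Ω)
    (X : Fin M → Ω → EuclideanSpace ℝ (Fin n)) (S : Ω → Finset (Fin M))
    (Z : Ω → EuclideanSpace ℝ (Fin n)) : Prop where
  law_X : ∀ m, HasLaw (X m) (stdGaussian (EuclideanSpace ℝ (Fin n))) μ
  indep_X : iIndepFun X μ
  law_Z : HasLaw Z (stdGaussian (EuclideanSpace ℝ (Fin n))) μ
  indep_Z : IndepFun (fun ω m => X m ω) Z μ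
  measurable_S : Measurable S
  card_S : ∀ ω, (S ω).card = K
  indep_S : IndepFun S (fun ω => ((fun m => X m ω), Z ω)) μ

/-! ### Moments of the standard Gaussian vector and of its norm. -/

section StdGaussian

/-! Fix the transmitted set `s`. By the symmetry `g ↦ -g`, conditioning on the hemisphere event
replaces each transmitted generator by an independent Gaussian vector flipped towards `u`, and the
event has probability `2⁻ᴷ` whatever `s` is (`pi_stdGaussian_restrict_hemisphereVectors`). It is
therefore enough to bound the error probability under this product law uniformly over sets of size
`K`; averaging over the law of `S` then costs nothing (`cond_transmittedInHemisphere_le`).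

Let `T` be the sum of the `K` unit directions and `A = ⟪u, T⟫`. Each direction has component along
`u` of mean about `√(2/π)/√n` and second moment at most `1/n`, so `√(P/n) A` concentrates at `k₀ = β
√P √(2/π)`. The parts orthogonal to `u` are independent and centred, so by Pythagoras `‖T‖² = A² + W
+ K - D`, where `W` collects their pairwise inner products and `D` is the sum of the squared
components along `u`. After multiplication by `P/n`, both `W` (by the second moment bound
`integral_norm_sum_sq_sub_sq_le`) and `D` (by Markov) vanish, while `K` contributes `Pβ`. The noise
has norm of order `√n` and disappears on dividing `Y` by `n`.

Hence `⟪u, Y⟫/n → k₀` and `‖Y‖/n → √(k₀² + Pβ)`, and the ratio of the limits is the claimed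
constant. Continuity of the ratio (`exists_pos_forall_abs_ratio_sub_lt`) reduces everything to
Markov and Chebyshev estimates, whose total is `O(1/n)`. -/

theorem integral_abs_gaussianReal :
    ∫ x, |x| ∂(gaussianReal 0 1) = Real.sqrt (2 / Real.pi) := by
  rw [integral_gaussianReal_eq_integral_smul one_ne_zero]
  have h1 : ∀ x : ℝ, gaussianPDFReal 0 1 x • |x|
      = (fun y : ℝ => (Real.sqrt (2 * Real.pi))⁻¹ * (y ^ (1 : ℝ) * Real.exp (-(1 / 2) * y ^ (2 : ℝ))))
          |x| := by
    intro x
    simp only [gaussianPDFReal, smul_eq_mul, NNReal.coe_one, mul_one, sub_zero, Real.rpow_one,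
      Real.rpow_two, sq_abs]
    rw [show -x ^ 2 / 2 = -(1 / 2) * x ^ 2 by ring]
    ring
  simp_rw [h1]
  rw [integral_comp_abs (f := fun y : ℝ => (Real.sqrt (2 * Real.pi))⁻¹ *
      (y ^ (1 : ℝ) * Real.exp (-(1 / 2) * y ^ (2 : ℝ)))), integral_const_mul,
    integral_rpow_mul_exp_neg_mul_rpow (by norm_num) (by norm_num) (by norm_num)]
  norm_num
  have h2 : Real.sqrt 2 * Real.sqrt 2 = 2 := Real.mul_self_sqrt (by norm_num)
  have h3 : Real.sqrt 2 ≠ 0 := by positivity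
  have h4 : Real.sqrt Real.pi ≠ 0 := by positivity
  field_simp
  nlinarith

variable {n : ℕ} {u : EuclideanSpace ℝ (Fin n)}

theorem map_inner_stdGaussian (hu : ‖u‖ = 1) :
    (stdGaussian (EuclideanSpace ℝ (Fin n))).map (fun g => inner ℝ u g) = gaussianReal 0 1 := by
  have h := IsGaussian.map_eq_gaussianReal (μ := stdGaussian (EuclideanSpace ℝ (Fin n)))
    (innerSL ℝ u)
  rw [integral_strongDual_stdGaussian, variance_dual_stdGaussian, innerSL_apply_norm, hu] at h
  simpa using h

theorem stdGaussian_inner_eq_zero (hu : ‖u‖ = 1) :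
    stdGaussian (EuclideanSpace ℝ (Fin n)) {g | inner ℝ u g = 0} = 0 := by
  have : {g : EuclideanSpace ℝ (Fin n) | inner ℝ u g = 0} = (fun g => inner ℝ u g) ⁻¹' {(0 : ℝ)} := rfl
  rw [this, ← Measure.map_apply (by fun_prop) (measurableSet_singleton _),
    map_inner_stdGaussian hu]
  have := nullSingletonClass_gaussianReal (μ := 0) (one_ne_zero : (1 : NNReal) ≠ 0)
  exact measure_singleton _

theorem integral_abs_inner_stdGaussian (hu : ‖u‖ = 1) :
    ∫ g, |inner ℝ u g| ∂(stdGaussian (EuclideanSpace ℝ (Fin n))) = Real.sqrt (2 / Real.pi) := by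
  rw [← integral_abs_gaussianReal, ← map_inner_stdGaussian hu,
    integral_map (by fun_prop) (by fun_prop)]

theorem memLp_sq_gaussianReal : MemLp (fun x : ℝ => x ^ 2) 2 (gaussianReal 0 1) := by
  -- Square integrability of `x²` is the finite fourth moment: the exponent `4` divided by the power
  -- `2`.
  have h := (memLp_id_gaussianReal (μ := 0) (v := 1) 4).norm_rpow_div 2
  have e : ((4 : NNReal) : ENNReal) / 2 = 2 := by
    rw [← ENNReal.toReal_eq_toReal_iff' (by finiteness) (by finiteness)]
    norm_num
  rw [e] at h
  simpa using h

theorem norm_sq_comp_toLp :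
    (fun g : EuclideanSpace ℝ (Fin n) => ‖g‖ ^ 2) ∘ (WithLp.toLp 2)
      = ∑ i : Fin n, fun x : Fin n → ℝ => (x i) ^ 2 := by
  ext x
  simp [EuclideanSpace.real_norm_sq_eq]

theorem memLp_norm_sq_stdGaussian :
    MemLp (fun g => ‖g‖ ^ 2) 2 (stdGaussian (EuclideanSpace ℝ (Fin n))) := by
  rw [← map_pi_eq_stdGaussian, memLp_map_measure_iff (by fun_prop) (by fun_prop),
    norm_sq_comp_toLp]
  exact memLp_finsetSum' _ fun i _ =>
    memLp_sq_gaussianReal.comp_measurePreserving (measurePreserving_eval _ i)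

theorem variance_norm_sq_stdGaussian :
    Var[fun g => ‖g‖ ^ 2; stdGaussian (EuclideanSpace ℝ (Fin n))]
      = n * Var[fun x => x ^ 2; gaussianReal 0 1] := by
  rw [← map_pi_eq_stdGaussian, variance_map (by fun_prop) (by fun_prop), norm_sq_comp_toLp,
    variance_sum_pi (X := fun _ x => x ^ 2) fun _ => memLp_sq_gaussianReal]
  simp

theorem integral_inner_sq_stdGaussian (hu : ‖u‖ = 1) :
    ∫ g, inner ℝ u g ^ 2 ∂(stdGaussian (EuclideanSpace ℝ (Fin n))) = 1 := by
  have h := variance_dual_stdGaussian (innerSL ℝ u)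
  rw [variance_of_integral_eq_zero (by fun_prop)
    (integral_strongDual_stdGaussian _), innerSL_apply_norm, hu] at h
  simpa [innerSL_apply_apply ℝ] using h

theorem integrable_norm_sq_stdGaussian :
    Integrable (fun g => ‖g‖ ^ 2) (stdGaussian (EuclideanSpace ℝ (Fin n))) :=
  memLp_norm_sq_stdGaussian.integrable (by norm_num)

theorem integral_norm_sq_stdGaussian :
    ∫ g, ‖g‖ ^ 2 ∂(stdGaussian (EuclideanSpace ℝ (Fin n))) = n := by
  have h : ∀ g : EuclideanSpace ℝ (Fin n),
      ‖g‖ ^ 2 = ∑ i, inner ℝ (EuclideanSpace.basisFun (Fin n) ℝ i) g ^ 2 := fun g =>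
    ((EuclideanSpace.basisFun (Fin n) ℝ).sum_sq_inner_right g).symm
  simp_rw [h]
  rw [integral_finsetSum]
  · simp_rw [integral_inner_sq_stdGaussian ((EuclideanSpace.basisFun (Fin n) ℝ).norm_eq_one _)]
    simp
  · intro i _
    refine integrable_norm_sq_stdGaussian.mono' (by fun_prop) (ae_of_all _ fun g => ?_)
    have := abs_real_inner_le_norm (EuclideanSpace.basisFun (Fin n) ℝ i) g
    rw [(EuclideanSpace.basisFun (Fin n) ℝ).norm_eq_one, one_mul] at this
    rw [Real.norm_eq_abs, abs_pow]
    exact pow_le_pow_left₀ (abs_nonneg _) this 2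

/-- Since `(‖g‖² - n)² = (√n - ‖g‖)² (√n + ‖g‖)² ≥ n (√n - ‖g‖)²`, and the variance of `‖g‖²` is `n`
times a constant, the norm stays within `O(1)` of `√n` in mean square. -/
theorem integral_sq_sqrt_sub_norm_le (hn : 0 < n) :
    ∫ g, (Real.sqrt n - ‖g‖) ^ 2 ∂(stdGaussian (EuclideanSpace ℝ (Fin n)))
      ≤ Var[fun x => x ^ 2; gaussianReal 0 1] := by
  have hn' : (0 : ℝ) < n := by exact_mod_cast hn
  have hv := variance_norm_sq_stdGaussian (n := n)
  rw [variance_eq_integral (by fun_prop), integral_norm_sq_stdGaussian] at hv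
  have hint : Integrable (fun g => (‖g‖ ^ 2 - n) ^ 2) (stdGaussian (EuclideanSpace ℝ (Fin n))) :=
    (memLp_norm_sq_stdGaussian.sub (memLp_const (n : ℝ))).integrable_sq
  calc ∫ g, (Real.sqrt n - ‖g‖) ^ 2 ∂(stdGaussian (EuclideanSpace ℝ (Fin n)))
      ≤ ∫ g, (n : ℝ)⁻¹ * (‖g‖ ^ 2 - n) ^ 2 ∂(stdGaussian (EuclideanSpace ℝ (Fin n))) := by
        refine integral_mono_of_nonneg (ae_of_all _ fun g => by positivity) (hint.const_mul _)
          (ae_of_all _ fun g => ?_)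
        simp only
        rw [inv_mul_eq_div, le_div_iff₀ hn']
        have h1 : (‖g‖ ^ 2 - n) ^ 2 = (Real.sqrt n - ‖g‖) ^ 2 * (Real.sqrt n + ‖g‖) ^ 2 := by
          rw [← mul_pow]
          nth_rewrite 1 [← Real.sq_sqrt hn'.le]
          ring
        rw [h1]
        refine mul_le_mul_of_nonneg_left ?_ (sq_nonneg _)
        nth_rewrite 1 [← Real.sq_sqrt hn'.le]
        exact pow_le_pow_left₀ (Real.sqrt_nonneg _) (le_add_of_nonneg_right (norm_nonneg _)) 2
    _ = _ := by
        rw [integral_const_mul, hv]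
        field_simp

end StdGaussian

/-! ### Rotation invariance and second moments of the uniform direction. -/

section NormalizedDirection

variable {n : ℕ} {u : EuclideanSpace ℝ (Fin n)}

@[fun_prop]
theorem measurable_normalizedDirection :
    Measurable (normalizedDirection (n := n)) := by
  unfold normalizedDirection
  fun_prop

theorem norm_normalizedDirection_le (g : EuclideanSpace ℝ (Fin n)) :
    ‖normalizedDirection g‖ ≤ 1 := by
  rw [normalizedDirection, norm_smul, norm_inv, norm_norm]
  exact inv_mul_le_one

theorem norm_normalizedDirection {g : EuclideanSpace ℝ (Fin n)} (hg : g ≠ 0) :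
    ‖normalizedDirection g‖ = 1 := by
  rw [normalizedDirection, norm_smul, norm_inv, norm_norm, inv_mul_cancel₀ (norm_ne_zero_iff.2 hg)]

theorem normalizedDirection_neg (g : EuclideanSpace ℝ (Fin n)) :
    normalizedDirection (-g) = -normalizedDirection g := by
  simp [normalizedDirection]

theorem normalizedDirection_map (f : EuclideanSpace ℝ (Fin n) ≃ₗᵢ[ℝ] EuclideanSpace ℝ (Fin n))
    (g : EuclideanSpace ℝ (Fin n)) : normalizedDirection (f g) = f (normalizedDirection g) := by
  simp [normalizedDirection]

theorem abs_inner_normalizedDirection_le (v g : EuclideanSpace ℝ (Fin n)) :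
    |inner ℝ v (normalizedDirection g)| ≤ ‖v‖ :=
  (abs_real_inner_le_norm _ _).trans
    (mul_le_of_le_one_right (norm_nonneg _) (norm_normalizedDirection_le g))

theorem integral_comp_isometry_stdGaussian
    (f : EuclideanSpace ℝ (Fin n) ≃ₗᵢ[ℝ] EuclideanSpace ℝ (Fin n))
    {H : Type*} [NormedAddCommGroup H] [NormedSpace ℝ H] (φ : EuclideanSpace ℝ (Fin n) → H) :
    ∫ g, φ (f g) ∂(stdGaussian (EuclideanSpace ℝ (Fin n)))
      = ∫ g, φ g ∂(stdGaussian (EuclideanSpace ℝ (Fin n))) := by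
  have h : MeasurePreserving f (stdGaussian (EuclideanSpace ℝ (Fin n)))
      (stdGaussian (EuclideanSpace ℝ (Fin n))) := ⟨by fun_prop, stdGaussian_map f⟩
  exact h.integral_comp f.toHomeomorph.measurableEmbedding φ

theorem integrable_inner_normalizedDirection_sq (v : EuclideanSpace ℝ (Fin n)) :
    Integrable (fun g => inner ℝ v (normalizedDirection g) ^ 2)
      (stdGaussian (EuclideanSpace ℝ (Fin n))) := by
  refine Integrable.of_bound (by fun_prop) (‖v‖ ^ 2) (ae_of_all _ fun g => ?_)
  rw [Real.norm_eq_abs, abs_pow]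
  exact pow_le_pow_left₀ (abs_nonneg _) (abs_inner_normalizedDirection_le v g) 2

/-- The reflection in the hyperplane orthogonal to `v - w` carries `v` to `w` and preserves the
Gaussian law. -/
theorem integral_inner_normalizedDirection_sq_eq {v w : EuclideanSpace ℝ (Fin n)}
    (h : ‖v‖ = ‖w‖) :
    ∫ g, inner ℝ v (normalizedDirection g) ^ 2 ∂(stdGaussian (EuclideanSpace ℝ (Fin n)))
      = ∫ g, inner ℝ w (normalizedDirection g) ^ 2 ∂(stdGaussian (EuclideanSpace ℝ (Fin n))) := by
  have e := Submodule.reflection_sub h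
  set f := Submodule.reflection (ℝ ∙ (v - w))ᗮ
  rw [← integral_comp_isometry_stdGaussian f (fun g => inner ℝ w (normalizedDirection g) ^ 2)]
  refine integral_congr_ae (ae_of_all _ fun g => ?_)
  simp only
  rw [normalizedDirection_map, ← e, LinearIsometryEquiv.inner_map_map]

/-- The `n` squared coordinates have equal means by symmetry and sum to at most `1`; an inequality
suffices, so the zero vector needs no separate treatment. -/
theorem integral_inner_normalizedDirection_sq_le_of_norm_eq_one (hn : 0 < n) (hu : ‖u‖ = 1) :
    ∫ g, inner ℝ u (normalizedDirection g) ^ 2 ∂(stdGaussian (EuclideanSpace ℝ (Fin n)))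
      ≤ (n : ℝ)⁻¹ := by
  set b := EuclideanSpace.basisFun (Fin n) ℝ
  have hsum : ∑ i, ∫ g, inner ℝ (b i) (normalizedDirection g) ^ 2
      ∂(stdGaussian (EuclideanSpace ℝ (Fin n))) ≤ 1 := by
    rw [← integral_finsetSum _ fun i _ => integrable_inner_normalizedDirection_sq (b i)]
    simp_rw [b.sum_sq_inner_right]
    calc _ ≤ ∫ g, (1 : ℝ) ∂(stdGaussian (EuclideanSpace ℝ (Fin n))) :=
          integral_mono_of_nonneg (ae_of_all _ fun g => by positivity) (integrable_const 1)
            (ae_of_all _ fun g => pow_le_one₀ (norm_nonneg _) (norm_normalizedDirection_le g))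
      _ = 1 := by simp
  have h1 : ∀ i, ∫ g, inner ℝ (b i) (normalizedDirection g) ^ 2
      ∂(stdGaussian (EuclideanSpace ℝ (Fin n)))
      = ∫ g, inner ℝ u (normalizedDirection g) ^ 2 ∂(stdGaussian (EuclideanSpace ℝ (Fin n))) :=
    fun i => integral_inner_normalizedDirection_sq_eq ((b.norm_eq_one i).trans hu.symm)
  simp_rw [h1] at hsum
  rw [Finset.sum_const, Finset.card_univ, Fintype.card_fin, nsmul_eq_mul] at hsum
  rwa [← one_div, le_div_iff₀' (by exact_mod_cast hn)]

theorem integral_inner_normalizedDirection_sq_le (hn : 0 < n) (v : EuclideanSpace ℝ (Fin n)) :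
    ∫ g, inner ℝ v (normalizedDirection g) ^ 2 ∂(stdGaussian (EuclideanSpace ℝ (Fin n)))
      ≤ (n : ℝ)⁻¹ * ‖v‖ ^ 2 := by
  rcases eq_or_ne v 0 with rfl | hv
  · simp
  have h := integral_inner_normalizedDirection_sq_le_of_norm_eq_one hn
    (norm_smul_inv_norm (𝕜 := ℝ) hv)
  have hv' : 0 < ‖v‖ ^ 2 := by positivity
  simp only [real_inner_smul_left, mul_pow, integral_const_mul] at h
  have h' := mul_le_mul_of_nonneg_right h hv'.le
  refine le_trans (le_of_eq ?_) h'
  simp only [RCLike.ofReal_real_eq_id, id_eq]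
  field_simp

end NormalizedDirection

/-! ### Second moments of sums of independent centred bounded vectors. -/

section OffDiagonal

theorem norm_sum_le_card {ι Ω F : Type*} [NormedAddCommGroup F] {a : ι → Ω → F}
    (hb : ∀ i ω, ‖a i ω‖ ≤ 1) (s : Finset ι) (ω : Ω) : ‖∑ i ∈ s, a i ω‖ ≤ s.card := by
  simpa using norm_sum_le_of_le s (fun i _ => hb i ω)

theorem integral_inner_eq_zero_of_indepFun {Ω F : Type*} [MeasurableSpace Ω] {μ : Measure Ω}
    [NormedAddCommGroup F] [InnerProductSpace ℝ F] [FiniteDimensional ℝ F] [MeasurableSpace F]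
    [BorelSpace F] {T b : Ω → F} (hTb : IndepFun T b μ)
    (hT : Integrable T μ) (hb : Integrable b μ) (h0 : ∫ ω, b ω ∂μ = 0) :
    ∫ ω, inner ℝ (T ω) (b ω) ∂μ = 0 := by
  have := hTb.integral_bilin hT hb (innerSL ℝ)
  simpa [h0, innerSL_apply_apply ℝ] using this

theorem iIndepFun.indepFun_comp_of_notMem {ι Ω F : Type*} [MeasurableSpace Ω] {μ : Measure Ω}
    [MeasurableSpace F] {a : ι → Ω → F} (ha : iIndepFun a μ) (hm : ∀ i, Measurable (a i)) {s : Finset ι}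
    {i : ι} (hi : i ∉ s) {G : Type*} [MeasurableSpace G] {f : (s → F) → G} (hf : Measurable f) :
    IndepFun (fun ω => f (fun j : s => a j ω)) (a i) μ := by
  have h := ha.indepFun_finset s {i} (Finset.disjoint_singleton_right.2 hi) hm
  have hψ : Measurable fun x : ({i} : Finset ι) → F => x ⟨i, Finset.mem_singleton_self i⟩ :=
    measurable_pi_apply _
  exact h.comp hf hψ

variable {ι Ω F : Type*} [MeasurableSpace Ω] {μ : Measure Ω} [IsProbabilityMeasure μ]
  [NormedAddCommGroup F] [InnerProductSpace ℝ F] [FiniteDimensional ℝ F] [MeasurableSpace F]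
  [BorelSpace F] {a : ι → Ω → F}

theorem integrable_of_abs_le {f : Ω → ℝ} (hf : Measurable f) {C : ℝ} (hC : ∀ ω, |f ω| ≤ C) :
    Integrable f μ :=
  Integrable.of_bound hf.aestronglyMeasurable C (ae_of_all _ hC)

/-- By independence `T` can be frozen: Fubini, then `h2` applied at each fixed value of `T`. -/
theorem integral_inner_sq_le_of_indepFun {T b : Ω → F} (hTb : IndepFun T b μ)
    (hT : Measurable T) (hb : Measurable b) {C : ℝ} (hTC : ∀ ω, ‖T ω‖ ≤ C) (hb1 : ∀ ω, ‖b ω‖ ≤ 1)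
    {κ : ℝ} (h2 : ∀ v, ∫ ω, inner ℝ v (b ω) ^ 2 ∂μ ≤ κ * ‖v‖ ^ 2) :
    ∫ ω, inner ℝ (T ω) (b ω) ^ 2 ∂μ ≤ κ * ∫ ω, ‖T ω‖ ^ 2 ∂μ := by
  have hmap := (indepFun_iff_map_prod_eq_prod_map_map hT.aemeasurable hb.aemeasurable).1 hTb
  have := Measure.isProbabilityMeasure_map (μ := μ) hT.aemeasurable
  have := Measure.isProbabilityMeasure_map (μ := μ) hb.aemeasurable
  have hmeas : Measurable (fun p : F × F => inner ℝ p.1 p.2 ^ 2) := by fun_prop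
  have hbd : ∀ ω, |inner ℝ (T ω) (b ω) ^ 2| ≤ (C * 1) ^ 2 := fun ω => by
    rw [abs_pow]
    refine pow_le_pow_left₀ (abs_nonneg _) ((abs_real_inner_le_norm _ _).trans ?_) 2
    exact mul_le_mul (hTC ω) (hb1 ω) (norm_nonneg _) ((norm_nonneg _).trans (hTC ω))
  have hint : Integrable (fun ω => inner ℝ (T ω) (b ω) ^ 2) μ :=
    integrable_of_abs_le (by fun_prop) hbd
  have hint' : Integrable (fun p : F × F => inner ℝ p.1 p.2 ^ 2) ((μ.map T).prod (μ.map b)) := by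
    rw [← hmap, integrable_map_measure hmeas.aestronglyMeasurable (by fun_prop)]
    exact hint
  have h1 : ∫ ω, inner ℝ (T ω) (b ω) ^ 2 ∂μ
      = ∫ p : F × F, inner ℝ p.1 p.2 ^ 2 ∂((μ.map T).prod (μ.map b)) := by
    rw [← hmap, integral_map (by fun_prop) hmeas.aestronglyMeasurable]
  have hTi : Integrable (fun t : F => ‖t‖ ^ 2) (μ.map T) := by
    rw [integrable_map_measure (by fun_prop) (by fun_prop)]
    refine integrable_of_abs_le (by fun_prop) (C := C ^ 2) fun ω => ?_
    simp only [Function.comp, abs_pow, abs_norm]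
    exact pow_le_pow_left₀ (norm_nonneg _) (hTC ω) 2
  rw [h1, integral_prod _ hint']
  calc ∫ t, ∫ y, inner ℝ t y ^ 2 ∂(μ.map b) ∂(μ.map T) ≤ ∫ t, κ * ‖t‖ ^ 2 ∂(μ.map T) := by
        refine integral_mono hint'.integral_prod_left (hTi.const_mul κ) fun t => ?_
        simp only
        rw [integral_map (by fun_prop) (by fun_prop)]
        exact h2 t
    _ = κ * ∫ ω, ‖T ω‖ ^ 2 ∂μ := by
        rw [integral_const_mul, integral_map (by fun_prop) (by fun_prop)]

theorem integral_norm_sum_sq_le (ha : iIndepFun a μ) (hm : ∀ i, Measurable (a i))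
    (hb : ∀ i ω, ‖a i ω‖ ≤ 1) (s : Finset ι) (h0 : ∀ i ∈ s, ∫ ω, a i ω ∂μ = 0) :
    ∫ ω, ‖∑ i ∈ s, a i ω‖ ^ 2 ∂μ ≤ s.card := by
  classical
  induction s using Finset.induction_on with
  | empty => simp
  | insert i s hi ih =>
    have ih := ih fun j hj => h0 j (Finset.mem_insert_of_mem hj)
    have hind : IndepFun (fun ω => ∑ j ∈ s, a j ω) (a i) μ := by
      have := iIndepFun.indepFun_comp_of_notMem (μ := μ) ha hm hi (f := fun x : s → F => ∑ j, x j) (by fun_prop)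
      have e : ∀ ω, ∑ j : s, a j ω = ∑ j ∈ s, a j ω := fun ω =>
        Finset.sum_coe_sort s (fun j => a j ω)
      simpa only [e] using this
    have hTi : Integrable (fun ω => ∑ j ∈ s, a j ω) μ :=
      Integrable.of_bound (by fun_prop) s.card (ae_of_all _ (norm_sum_le_card hb s))
    have hai : Integrable (a i) μ := Integrable.of_bound (by fun_prop) 1 (ae_of_all _ (hb i))
    have hz := integral_inner_eq_zero_of_indepFun hind hTi hai (h0 i (Finset.mem_insert_self i s))
    have hT2 : Integrable (fun ω => ‖∑ j ∈ s, a j ω‖ ^ 2) μ := by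
      refine integrable_of_abs_le (by fun_prop) (C := (s.card : ℝ) ^ 2) fun ω => ?_
      rw [abs_pow, abs_norm]
      exact pow_le_pow_left₀ (norm_nonneg _) (norm_sum_le_card hb s ω) 2
    have hTa : Integrable (fun ω => inner ℝ (∑ j ∈ s, a j ω) (a i ω)) μ := by
      refine integrable_of_abs_le (by fun_prop) (C := s.card * 1) fun ω => ?_
      exact (abs_real_inner_le_norm _ _).trans (mul_le_mul (norm_sum_le_card hb s ω) (hb i ω)
        (norm_nonneg _) (Nat.cast_nonneg _))
    have hadd : Integrable (fun ω => ‖∑ j ∈ s, a j ω‖ ^ 2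
        + 2 * inner ℝ (∑ j ∈ s, a j ω) (a i ω)) μ := hT2.add (hTa.const_mul 2)
    calc ∫ ω, ‖∑ j ∈ insert i s, a j ω‖ ^ 2 ∂μ
        ≤ ∫ ω, (‖∑ j ∈ s, a j ω‖ ^ 2 + 2 * inner ℝ (∑ j ∈ s, a j ω) (a i ω) + 1) ∂μ := by
          refine integral_mono_of_nonneg (ae_of_all _ fun ω => by positivity)
            (hadd.add (integrable_const 1)) (ae_of_all _ fun ω => ?_)
          simp only [Finset.sum_insert hi]
          rw [add_comm (a i ω), norm_add_sq_real]
          have := pow_le_one₀ (n := 2) (norm_nonneg _) (hb i ω)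
          linarith
      _ = ∫ ω, ‖∑ j ∈ s, a j ω‖ ^ 2 ∂μ + 1 := by
          rw [integral_add hadd (integrable_const 1),
            integral_add hT2 (hTa.const_mul 2), integral_const_mul, hz]
          simp
      _ ≤ (insert i s).card := by
          rw [Finset.card_insert_of_notMem hi]
          push_cast
          linarith

/-- The integrand is the square of the sum of cross terms. Adding a vector `a i` to the partial sum
`T` increases the cross terms by `2⟪T, a i⟫`, which is uncorrelated with the earlier ones because `a
i` is centred and independent of them, and has second moment at most `4κ E‖T‖² ≤ 4κ |s|`. Summing
these increments gives the quadratic bound. -/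
theorem integral_norm_sum_sq_sub_sq_le (ha : iIndepFun a μ) (hm : ∀ i, Measurable (a i))
    (hb : ∀ i ω, ‖a i ω‖ ≤ 1) (s : Finset ι) (h0 : ∀ i ∈ s, ∫ ω, a i ω ∂μ = 0) {κ : ℝ}
    (hκ : 0 ≤ κ) (h2 : ∀ i ∈ s, ∀ v, ∫ ω, inner ℝ v (a i ω) ^ 2 ∂μ ≤ κ * ‖v‖ ^ 2) :
    ∫ ω, (‖∑ i ∈ s, a i ω‖ ^ 2 - ∑ i ∈ s, ‖a i ω‖ ^ 2) ^ 2 ∂μ ≤ 2 * κ * (s.card : ℝ) ^ 2 := by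
  classical
  induction s using Finset.induction_on with
  | empty => simp
  | insert i s hi ih =>
    have h0s : ∀ j ∈ s, ∫ ω, a j ω ∂μ = 0 := fun j hj => h0 j (Finset.mem_insert_of_mem hj)
    have ih := ih h0s fun j hj => h2 j (Finset.mem_insert_of_mem hj)
    set T : Ω → F := fun ω => ∑ j ∈ s, a j ω with hTdef
    set W : Ω → ℝ := fun ω => ‖T ω‖ ^ 2 - ∑ j ∈ s, ‖a j ω‖ ^ 2 with hWdef
    have hTm : Measurable T := by fun_prop
    have hWm : Measurable W := by fun_prop
    have hTC : ∀ ω, ‖T ω‖ ≤ s.card := norm_sum_le_card hb s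
    have hWC : ∀ ω, |W ω| ≤ (s.card : ℝ) ^ 2 + s.card := fun ω => by
      have h1 : ‖T ω‖ ^ 2 ≤ (s.card : ℝ) ^ 2 := pow_le_pow_left₀ (norm_nonneg _) (hTC ω) 2
      have h3 : ∑ j ∈ s, ‖a j ω‖ ^ 2 ≤ s.card := by
        simpa using Finset.sum_le_sum (s := s) fun j _ => pow_le_one₀ (n := 2) (norm_nonneg _) (hb j ω)
      have h4 : 0 ≤ ∑ j ∈ s, ‖a j ω‖ ^ 2 := Finset.sum_nonneg fun j _ => by positivity
      have h5 : 0 ≤ ‖T ω‖ ^ 2 := by positivity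
      rw [abs_le]
      constructor <;> simp only [hWdef] <;> nlinarith
    have hind : IndepFun T (a i) μ := by
      have := iIndepFun.indepFun_comp_of_notMem (μ := μ) ha hm hi (f := fun x : s → F => ∑ j, x j) (by fun_prop)
      have e : ∀ ω, ∑ j : s, a j ω = ∑ j ∈ s, a j ω := fun ω =>
        Finset.sum_coe_sort s (fun j => a j ω)
      simpa only [e] using this
    have hindW : IndepFun (fun ω => W ω • T ω) (a i) μ := by
      have := iIndepFun.indepFun_comp_of_notMem (μ := μ) ha hm hi
        (f := fun x : s → F => (‖∑ j, x j‖ ^ 2 - ∑ j, ‖x j‖ ^ 2) • ∑ j, x j) (by fun_prop)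
      have e : ∀ ω, ∑ j : s, a j ω = ∑ j ∈ s, a j ω := fun ω =>
        Finset.sum_coe_sort s (fun j => a j ω)
      have e' : ∀ ω, ∑ j : s, ‖a j ω‖ ^ 2 = ∑ j ∈ s, ‖a j ω‖ ^ 2 := fun ω =>
        Finset.sum_coe_sort s (fun j => ‖a j ω‖ ^ 2)
      simpa only [e, e'] using this
    have hWT : Integrable (fun ω => W ω • T ω) μ := by
      refine Integrable.of_bound (by fun_prop) (((s.card : ℝ) ^ 2 + s.card) * s.card)
        (ae_of_all _ fun ω => ?_)
      rw [norm_smul, Real.norm_eq_abs]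
      exact mul_le_mul (hWC ω) (hTC ω) (norm_nonneg _) (by positivity)
    have hai : Integrable (a i) μ := Integrable.of_bound (by fun_prop) 1 (ae_of_all _ (hb i))
    have hz := integral_inner_eq_zero_of_indepFun hindW hWT hai (h0 i (Finset.mem_insert_self i s))
    have hq := integral_inner_sq_le_of_indepFun hind hTm (hm i) hTC (hb i)
      (h2 i (Finset.mem_insert_self i s))
    have hT2 := integral_norm_sum_sq_le ha hm hb s h0s
    have hTa : ∀ ω, |inner ℝ (T ω) (a i ω)| ≤ s.card * 1 := fun ω =>
      (abs_real_inner_le_norm _ _).trans (mul_le_mul (hTC ω) (hb i ω)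
        (norm_nonneg _) (Nat.cast_nonneg _))
    have hI1 : Integrable (fun ω => W ω ^ 2) μ := by
      refine integrable_of_abs_le (by fun_prop) (C := ((s.card : ℝ) ^ 2 + s.card) ^ 2) fun ω => ?_
      rw [abs_pow]
      exact pow_le_pow_left₀ (abs_nonneg _) (hWC ω) 2
    have hI2 : Integrable (fun ω => inner ℝ (W ω • T ω) (a i ω)) μ := by
      refine integrable_of_abs_le (by fun_prop)
        (C := ((s.card : ℝ) ^ 2 + s.card) * (s.card * 1)) fun ω => ?_
      rw [real_inner_smul_left, abs_mul]
      exact mul_le_mul (hWC ω) (hTa ω) (abs_nonneg _) (by positivity)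
    have hI3 : Integrable (fun ω => inner ℝ (T ω) (a i ω) ^ 2) μ := by
      refine integrable_of_abs_le (by fun_prop) (C := (s.card * 1 : ℝ) ^ 2) fun ω => ?_
      rw [abs_pow]
      exact pow_le_pow_left₀ (abs_nonneg _) (hTa ω) 2
    have hadd : Integrable (fun ω => W ω ^ 2 + 4 * inner ℝ (W ω • T ω) (a i ω)) μ :=
      hI1.add (hI2.const_mul 4)
    calc ∫ ω, (‖∑ j ∈ insert i s, a j ω‖ ^ 2 - ∑ j ∈ insert i s, ‖a j ω‖ ^ 2) ^ 2 ∂μ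
        = ∫ ω, (W ω ^ 2 + 4 * inner ℝ (W ω • T ω) (a i ω) + 4 * inner ℝ (T ω) (a i ω) ^ 2) ∂μ := by
          refine integral_congr_ae (ae_of_all _ fun ω => ?_)
          simp only [Finset.sum_insert hi]
          rw [add_comm (a i ω), norm_add_sq_real, real_inner_smul_left]
          simp only [hWdef, hTdef]
          ring
      _ = ∫ ω, W ω ^ 2 ∂μ + 4 * ∫ ω, inner ℝ (T ω) (a i ω) ^ 2 ∂μ := by
          rw [integral_add hadd (hI3.const_mul 4),
            integral_add hI1 (hI2.const_mul 4), integral_const_mul, integral_const_mul, hz]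
          simp
      _ ≤ 2 * κ * ((insert i s).card : ℝ) ^ 2 := by
          rw [Finset.card_insert_of_notMem hi]
          push_cast
          -- With `k = s.card`, what remains is `2κk² + 4κk ≤ 2κ(k+1)²`.
          have := mul_le_mul_of_nonneg_left hT2 hκ
          nlinarith

end OffDiagonal

/-! ### The Gaussian vector conditioned on a half-space. -/

section HemisphereGaussian

variable {n : ℕ}

/-- The vector among `±g` whose inner product with `u` is nonnegative. -/
noncomputable def flipToward (u g : EuclideanSpace ℝ (Fin n)) : EuclideanSpace ℝ (Fin n) :=
  if 0 ≤ inner ℝ g u then g else -g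

/-- The law of a standard Gaussian vector flipped into the half-space with inner normal `u`. -/
noncomputable def hemisphereGaussian (u : EuclideanSpace ℝ (Fin n)) :
    Measure (EuclideanSpace ℝ (Fin n)) :=
  (stdGaussian (EuclideanSpace ℝ (Fin n))).map (flipToward u)

variable {u : EuclideanSpace ℝ (Fin n)}

@[fun_prop]
theorem measurable_flipToward (u : EuclideanSpace ℝ (Fin n)) : Measurable (flipToward u) :=
  Measurable.ite (measurableSet_le (by fun_prop) (by fun_prop)) (by fun_prop) (by fun_prop)

instance (u : EuclideanSpace ℝ (Fin n)) : IsProbabilityMeasure (hemisphereGaussian u) :=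
  Measure.isProbabilityMeasure_map (by fun_prop)

theorem flipToward_eq_or_eq_neg (u g : EuclideanSpace ℝ (Fin n)) :
    flipToward u g = g ∨ flipToward u g = -g := by
  unfold flipToward
  split_ifs <;> simp

theorem ae_inner_ne_zero_stdGaussian (hu : ‖u‖ = 1) :
    ∀ᵐ g ∂(stdGaussian (EuclideanSpace ℝ (Fin n))), inner ℝ g u ≠ 0 := by
  rw [ae_iff]
  simpa [real_inner_comm] using stdGaussian_inner_eq_zero hu

theorem stdGaussian_preimage_neg (A : Set (EuclideanSpace ℝ (Fin n))) (hA : MeasurableSet A) :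
    stdGaussian (EuclideanSpace ℝ (Fin n)) ((fun g => -g) ⁻¹' A)
      = stdGaussian (EuclideanSpace ℝ (Fin n)) A := by
  have h := stdGaussian_map (LinearIsometryEquiv.neg ℝ (E := EuclideanSpace ℝ (Fin n)))
  conv_rhs => rw [← h, Measure.map_apply (LinearIsometryEquiv.continuous _).measurable hA]
  rfl

theorem measurableSet_ne_zero_inner_nonneg (u : EuclideanSpace ℝ (Fin n)) :
    MeasurableSet {g : EuclideanSpace ℝ (Fin n) | g ≠ 0 ∧ 0 ≤ inner ℝ g u} := by
  have h : MeasurableSet {g : EuclideanSpace ℝ (Fin n) | 0 ≤ inner ℝ g u} :=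
    measurableSet_le (by fun_prop) (by fun_prop)
  exact (measurableSet_singleton 0).compl.inter h

/-- The flip folds the two half-spaces onto each other. They carry equal mass by `g ↦ -g` and the
separating hyperplane is null, so the folded law is twice the restriction. -/
theorem stdGaussian_restrict_hemisphere (hu : ‖u‖ = 1) :
    (stdGaussian (EuclideanSpace ℝ (Fin n))).restrict {g | g ≠ 0 ∧ 0 ≤ inner ℝ g u}
      = (2 : ENNReal)⁻¹ • hemisphereGaussian u := by
  ext A hA
  have hH0 : MeasurableSet {g : EuclideanSpace ℝ (Fin n) | 0 < inner ℝ g u} :=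
    measurableSet_lt (by fun_prop) (by fun_prop)
  have h1 : stdGaussian (EuclideanSpace ℝ (Fin n)) (A ∩ {g | g ≠ 0 ∧ 0 ≤ inner ℝ g u})
      = stdGaussian (EuclideanSpace ℝ (Fin n)) (A ∩ {g | 0 < inner ℝ g u}) := by
    refine measure_congr ?_
    filter_upwards [ae_inner_ne_zero_stdGaussian hu] with g hg
    refine propext (and_congr_right fun _ => ⟨fun h => lt_of_le_of_ne h.2 hg.symm, fun h => ⟨?_, h.le⟩⟩)
    rintro rfl
    simp at hg
  have h2 : flipToward u ⁻¹' A ∩ {g | 0 < inner ℝ g u} = A ∩ {g | 0 < inner ℝ g u} := by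
    ext g
    refine and_congr_left fun hg => ?_
    have hg' : 0 ≤ inner ℝ g u := le_of_lt hg
    simp [flipToward, hg']
  have h3 : stdGaussian (EuclideanSpace ℝ (Fin n)) (flipToward u ⁻¹' A \ {g | 0 < inner ℝ g u})
      = stdGaussian (EuclideanSpace ℝ (Fin n)) (A ∩ {g | 0 < inner ℝ g u}) := by
    rw [← stdGaussian_preimage_neg _ (hA.inter hH0)]
    refine measure_congr ?_
    filter_upwards [ae_inner_ne_zero_stdGaussian hu] with g hg
    refine propext ?_
    change (flipToward u g ∈ A ∧ ¬ 0 < inner ℝ g u) ↔ (-g ∈ A ∧ 0 < inner ℝ (-g) u)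
    rw [inner_neg_left, neg_pos, not_lt]
    refine ⟨fun ⟨ha, hb⟩ => ?_, fun ⟨ha, hb⟩ => ?_⟩
    · have hb' := lt_of_le_of_ne hb hg
      exact ⟨by simpa [flipToward, not_le.2 hb'] using ha, hb'⟩
    · exact ⟨by simpa [flipToward, not_le.2 hb] using ha, hb.le⟩
  rw [Measure.restrict_apply hA, h1, Measure.smul_apply, hemisphereGaussian,
    Measure.map_apply (by fun_prop) hA, ← measure_inter_add_sdiff (flipToward u ⁻¹' A) hH0, h2, h3, smul_eq_mul,
    ← two_mul, ← mul_assoc, ENNReal.inv_mul_cancel (by simp) (by simp), one_mul]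

theorem integral_hemisphereGaussian {H : Type*} [NormedAddCommGroup H] [NormedSpace ℝ H]
    {φ : EuclideanSpace ℝ (Fin n) → H} (hφ : StronglyMeasurable φ) :
    ∫ g, φ g ∂(hemisphereGaussian u)
      = ∫ g, φ (flipToward u g) ∂(stdGaussian (EuclideanSpace ℝ (Fin n))) :=
  integral_map (by fun_prop) hφ.aestronglyMeasurable

theorem integral_inner_normalizedDirection_sq_hemisphereGaussian_le (hn : 0 < n)
    (v : EuclideanSpace ℝ (Fin n)) :
    ∫ g, inner ℝ v (normalizedDirection g) ^ 2 ∂(hemisphereGaussian u) ≤ (n : ℝ)⁻¹ * ‖v‖ ^ 2 := by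
  rw [integral_hemisphereGaussian (Measurable.stronglyMeasurable (by fun_prop))]
  refine le_trans (le_of_eq ?_) (integral_inner_normalizedDirection_sq_le hn v)
  refine integral_congr_ae (ae_of_all _ fun g => ?_)
  rcases flipToward_eq_or_eq_neg u g with h | h <;> simp [h, normalizedDirection_neg]

theorem integral_inner_normalizedDirection_hemisphereGaussian :
    ∫ g, inner ℝ u (normalizedDirection g) ∂(hemisphereGaussian u)
      = ∫ g, |inner ℝ u (normalizedDirection g)| ∂(stdGaussian (EuclideanSpace ℝ (Fin n))) := by
  rw [integral_hemisphereGaussian (Measurable.stronglyMeasurable (by fun_prop))]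
  refine integral_congr_ae (ae_of_all _ fun g => ?_)
  have h0 : inner ℝ u (normalizedDirection g) = ‖g‖⁻¹ * inner ℝ g u := by
    rw [normalizedDirection, real_inner_smul_right, real_inner_comm]
  simp only [flipToward]
  split_ifs with h
  · rw [abs_of_nonneg]
    rw [h0]
    positivity
  · rw [normalizedDirection_neg, inner_neg_right, abs_of_nonpos]
    rw [h0]
    exact mul_nonpos_of_nonneg_of_nonpos (by positivity) (le_of_not_ge h)

theorem ae_ne_zero_hemisphereGaussian (hu : ‖u‖ = 1) : ∀ᵐ g ∂(hemisphereGaussian u), g ≠ 0 := by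
  have h0 : MeasurableSet {g : EuclideanSpace ℝ (Fin n) | g ≠ 0} := (measurableSet_singleton 0).compl
  rw [hemisphereGaussian, ae_map_iff (by fun_prop) h0]
  filter_upwards [ae_inner_ne_zero_stdGaussian hu] with g hg h
  have h0 : g = 0 := by
    rcases flipToward_eq_or_eq_neg u g with h' | h' <;> rw [h'] at h <;> simpa using h
  simp [h0] at hg

/-- The reflection fixing the line through `u` commutes with the flip and negates the orthogonal
part, so the integral equals its own negative. -/
theorem integral_orthogonal_normalizedDirection_hemisphereGaussian (hu : ‖u‖ = 1) :
    ∫ g, (normalizedDirection g - inner ℝ u (normalizedDirection g) • u) ∂(hemisphereGaussian u)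
      = 0 := by
  rw [integral_hemisphereGaussian (Measurable.stronglyMeasurable (by fun_prop))]
  set f := Submodule.reflection (ℝ ∙ u) with hf
  have hfu : f u = u := Submodule.reflection_mem_subspace_eq_self (Submodule.mem_span_singleton_self u)
  have hfg : ∀ g, f g = 2 • (inner ℝ u g • u) - g := fun g => by
    rw [hf, Submodule.reflection_singleton_apply, hu]
    simp
  have hinner : ∀ g, inner ℝ (f g) u = inner ℝ g u := fun g => by
    conv_lhs => rw [← hfu, LinearIsometryEquiv.inner_map_map]
  have hflip : ∀ g, flipToward u (f g) = f (flipToward u g) := fun g => by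
    simp only [flipToward, hinner]
    split_ifs <;> simp
  set φ := fun g : EuclideanSpace ℝ (Fin n) => normalizedDirection (flipToward u g) -
    inner ℝ u (normalizedDirection (flipToward u g)) • u with hφ
  have hneg : ∀ g, φ (f g) = -φ g := fun g => by
    simp only [hφ, hflip, normalizedDirection_map]
    set w := normalizedDirection (flipToward u g)
    rw [real_inner_comm, hinner, real_inner_comm, hfg]
    module
  have h := integral_comp_isometry_stdGaussian f φ
  simp_rw [hneg, integral_neg] at h
  have h2 : (2 : ℝ) • ∫ g, φ g ∂(stdGaussian (EuclideanSpace ℝ (Fin n))) = 0 := by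
    rw [two_smul]
    nth_rewrite 1 [← h]
    exact neg_add_cancel _
  exact (smul_eq_zero.1 h2).resolve_left two_ne_zero

/-- Compare with `E|⟪u, g⟫| = √(2/π)`, writing `|⟪u, g⟫|` as `‖g‖` times the component of the
direction. The discrepancy is `|√n - ‖g‖|` times that component; bounding this product by a weighted
sum of squares uses only second moments and avoids independence of norm and direction. -/
theorem abs_sqrt_mul_integral_abs_inner_sub_le (hn : 0 < n) (hu : ‖u‖ = 1) :
    |Real.sqrt n * ∫ g, |inner ℝ u (normalizedDirection g)| ∂(stdGaussian (EuclideanSpace ℝ (Fin n)))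
        - Real.sqrt (2 / Real.pi)|
      ≤ (1 + Var[fun x => x ^ 2; gaussianReal 0 1]) / (2 * Real.sqrt n) := by
  have hn' : 0 < Real.sqrt n := Real.sqrt_pos.2 (by exact_mod_cast hn)
  set γ := stdGaussian (EuclideanSpace ℝ (Fin n)) with hγ
  have hi1 : Integrable (fun g => |inner ℝ u (normalizedDirection g)|) γ := by
    refine Integrable.of_bound (by fun_prop) 1 (ae_of_all _ fun g => ?_)
    rw [Real.norm_eq_abs, abs_abs, ← hu]
    exact abs_inner_normalizedDirection_le u g
  have hnorm : MemLp (fun g => ‖g‖) 2 γ :=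
    (memLp_two_iff_integrable_sq (by fun_prop)).2 integrable_norm_sq_stdGaussian
  have hi2 : Integrable (fun g => |inner ℝ u g|) γ := by
    refine (hnorm.integrable (by norm_num)).mono' (by fun_prop) (ae_of_all _ fun g => ?_)
    rw [Real.norm_eq_abs, abs_abs]
    simpa [hu] using abs_real_inner_le_norm u g
  have hi3 : Integrable (fun g => (Real.sqrt n - ‖g‖) ^ 2) γ :=
    ((memLp_const (Real.sqrt n)).sub hnorm).integrable_sq
  have hi4 := integrable_inner_normalizedDirection_sq u
  rw [← integral_abs_inner_stdGaussian hu, ← integral_const_mul,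
    ← integral_sub (hi1.const_mul _) hi2]
  calc _ ≤ ∫ g, abs (Real.sqrt n * |inner ℝ u (normalizedDirection g)| - |inner ℝ u g|) ∂γ :=
        abs_integral_le_integral_abs
    _ ≤ ∫ g, (Real.sqrt n / 2 * inner ℝ u (normalizedDirection g) ^ 2
          + (2 * Real.sqrt n)⁻¹ * (Real.sqrt n - ‖g‖) ^ 2) ∂γ := by
        refine integral_mono_of_nonneg (ae_of_all _ fun g => abs_nonneg _)
          ((hi4.const_mul _).add (hi3.const_mul _)) (ae_of_all _ fun g => ?_)
        simp only
        have e : |inner ℝ u g| = ‖g‖ * |inner ℝ u (normalizedDirection g)| := by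
          rcases eq_or_ne g 0 with rfl | hg
          · simp
          · rw [normalizedDirection, real_inner_smul_right, abs_mul, abs_inv, abs_norm,
              mul_inv_cancel_left₀ (norm_ne_zero_iff.2 hg)]
        rw [e, ← sub_mul, abs_mul, abs_abs, ← sq_abs (inner ℝ u _), ← sq_abs (Real.sqrt n - ‖g‖)]
        -- Weighted AM-GM for `y * x`. As `x²` has mean at most `1/n` and `y²` bounded mean, the
        -- weights `√n / 2` and `1 / (2√n)` make both terms `O(1/√n)`.
        set x := |inner ℝ u (normalizedDirection g)|
        set y := |Real.sqrt n - ‖g‖|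
        have h2 : Real.sqrt n / 2 * x ^ 2 + (2 * Real.sqrt n)⁻¹ * y ^ 2 - y * x
            = (2 * Real.sqrt n)⁻¹ * (Real.sqrt n * x - y) ^ 2 := by
          field_simp
          ring
        have h3 : 0 ≤ (2 * Real.sqrt n)⁻¹ * (Real.sqrt n * x - y) ^ 2 := by positivity
        linarith
    _ ≤ Real.sqrt n / 2 * (n : ℝ)⁻¹
          + (2 * Real.sqrt n)⁻¹ * Var[fun x => x ^ 2; gaussianReal 0 1] := by
        rw [integral_add (hi4.const_mul _) (hi3.const_mul _), integral_const_mul, integral_const_mul]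
        gcongr
        · exact integral_inner_normalizedDirection_sq_le_of_norm_eq_one hn hu
        · exact integral_sq_sqrt_sub_norm_le hn
    _ = _ := by
        have : (n : ℝ) = Real.sqrt n * Real.sqrt n := (Real.mul_self_sqrt (Nat.cast_nonneg n)).symm
        nth_rewrite 2 [this]
        field_simp

end HemisphereGaussian

/-! ### The limiting ratio and its continuity. -/

section Limit

theorem signal_div_sqrt_eq {β P : ℝ} (hβ : 0 < β) (hP : 0 < P) :
    β * (Real.sqrt P * Real.sqrt (2 / Real.pi)) /
        Real.sqrt ((β * (Real.sqrt P * Real.sqrt (2 / Real.pi))) ^ 2 + P * β)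
      = Real.sqrt (2 * β / (2 * β + Real.pi)) := by
  have hpi := Real.pi_pos
  set k := β * (Real.sqrt P * Real.sqrt (2 / Real.pi)) with hk
  have hk2 : k ^ 2 = β ^ 2 * (P * (2 / Real.pi)) := by
    rw [hk, mul_pow, mul_pow, Real.sq_sqrt hP.le, Real.sq_sqrt (by positivity)]
  have hk0 : 0 ≤ k := by positivity
  rw [← Real.sqrt_sq hk0, ← Real.sqrt_div (sq_nonneg _), Real.sqrt_sq hk0, hk2]
  congr 1
  field_simp

/-- Interface between analysis and probability: `k` is the mean signal, `l` the codeword power, `a`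
the signal fluctuation, `b` the cross terms, `d` the squared components along `u`, and `e`, `f` the
noise in numerator and denominator. The ratio is continuous at the limit point because its
denominator there is `√(k₀² + Pβ) > 0`. -/
theorem exists_pos_forall_abs_ratio_sub_lt {β P ε : ℝ} (hβ : 0 < β) (hP : 0 < P) (hε : 0 < ε) :
    ∃ η > 0, ∀ k l a b d e f : ℝ,
      |k - β * (Real.sqrt P * Real.sqrt (2 / Real.pi))| < η → |l - P * β| < η →
      |a| < η → |b| < η → |d| < η → |e| < η → |f| < η →
      |(k + a + e) / (Real.sqrt ((k + a) ^ 2 + b + l - d) + f)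
        - Real.sqrt (2 * β / (2 * β + Real.pi))| < ε := by
  set k₀ := β * (Real.sqrt P * Real.sqrt (2 / Real.pi)) with hk₀
  set F : ℝ × ℝ × ℝ × ℝ × ℝ × ℝ × ℝ → ℝ := fun p =>
    (p.1 + p.2.2.1 + p.2.2.2.2.2.1) /
      (Real.sqrt ((p.1 + p.2.2.1) ^ 2 + p.2.2.2.1 + p.2.1 - p.2.2.2.2.1) + p.2.2.2.2.2.2) with hF
  have hF0 : F (k₀, P * β, 0, 0, 0, 0, 0) = Real.sqrt (2 * β / (2 * β + Real.pi)) := by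
    rw [← signal_div_sqrt_eq hβ hP]
    simp [hF, hk₀]
  have hcont : ContinuousAt F (k₀, P * β, 0, 0, 0, 0, 0) := by
    refine ContinuousAt.div (by fun_prop) (by fun_prop) ?_
    have : 0 < k₀ ^ 2 + P * β := by positivity
    simpa using (Real.sqrt_pos.2 this).ne'
  obtain ⟨η, hη, h⟩ := Metric.continuousAt_iff.1 hcont ε hε
  refine ⟨η, hη, fun k l a b d e f hk hl ha hb hd he hf => ?_⟩
  have := @h (k, l, a, b, d, e, f) (by
    simp only [Prod.dist_eq, Real.dist_eq, sub_zero, sup_lt_iff]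
    exact ⟨hk, hl, ha, hb, hd, he, hf⟩)
  rwa [hF0, Real.dist_eq] at this

end Limit

/-! ### Markov and Chebyshev inequalities in explicit form. -/

section Markov

theorem measure_ge_le_ofReal_div {α : Type*} [MeasurableSpace α] {μ : Measure α}
    [IsProbabilityMeasure μ] {f : α → ℝ} (hf : ∀ x, 0 ≤ f x) (hint : Integrable f μ) {B c : ℝ}
    (hB : ∫ x, f x ∂μ ≤ B) (hc : 0 < c) : μ {x | c ≤ f x} ≤ ENNReal.ofReal (B / c) := by
  rw [← ofReal_measureReal]
  refine ENNReal.ofReal_le_ofReal ?_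
  rw [le_div_iff₀' hc]
  exact (mul_meas_ge_le_integral_of_nonneg (ae_of_all _ hf) hint c).trans hB

theorem measure_abs_ge_le_ofReal_div_sq {α : Type*} [MeasurableSpace α] {μ : Measure α}
    [IsProbabilityMeasure μ] {f : α → ℝ} (hint : Integrable (fun x => f x ^ 2) μ) {B c : ℝ}
    (hB : ∫ x, f x ^ 2 ∂μ ≤ B) (hc : 0 < c) :
    μ {x | c ≤ |f x|} ≤ ENNReal.ofReal (B / c ^ 2) := by
  refine le_trans (measure_mono fun x hx => ?_)
    (measure_ge_le_ofReal_div (fun x => sq_nonneg (f x)) hint hB (pow_pos hc 2))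
  have := pow_le_pow_left₀ hc.le hx 2
  rwa [sq_abs] at this

end Markov

/-! ### Concentration under the conditional codebook law. -/

section TransmittedLaw

variable {n M : ℕ}

/-- The law of the vectors generating the codebook given that the codewords indexed by `s` lie in
the hemisphere with axis `u`. -/
noncomputable def transmittedLaw (u : EuclideanSpace ℝ (Fin n)) (s : Finset (Fin M)) :
    Measure (Fin M → EuclideanSpace ℝ (Fin n)) :=
  Measure.pi fun m =>
    if m ∈ s then hemisphereGaussian u else stdGaussian (EuclideanSpace ℝ (Fin n))

instance (u : EuclideanSpace ℝ (Fin n)) (s : Finset (Fin M)) (m : Fin M) :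
    IsProbabilityMeasure
      (if m ∈ s then hemisphereGaussian u else stdGaussian (EuclideanSpace ℝ (Fin n))) := by
  split_ifs <;> infer_instance

instance (u : EuclideanSpace ℝ (Fin n)) (s : Finset (Fin M)) :
    IsProbabilityMeasure (transmittedLaw u s) := by
  unfold transmittedLaw
  infer_instance

variable {u : EuclideanSpace ℝ (Fin n)} {s : Finset (Fin M)}

theorem measurePreserving_eval_transmittedLaw {m : Fin M} (hm : m ∈ s) :
    MeasurePreserving (fun g => g m) (transmittedLaw u s) (hemisphereGaussian u) := by
  have h := measurePreserving_eval (fun m : Fin M =>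
    if m ∈ s then hemisphereGaussian u else stdGaussian (EuclideanSpace ℝ (Fin n))) m
  rw [if_pos hm] at h
  exact h

theorem integral_eval_transmittedLaw {H : Type*} [NormedAddCommGroup H] [NormedSpace ℝ H]
    {φ : EuclideanSpace ℝ (Fin n) → H} (hφ : StronglyMeasurable φ) {m : Fin M} (hm : m ∈ s) :
    ∫ g, φ (g m) ∂(transmittedLaw u s) = ∫ x, φ x ∂(hemisphereGaussian u) := by
  rw [← (measurePreserving_eval_transmittedLaw hm).map_eq,
    integral_map (measurable_pi_apply m).aemeasurable hφ.aestronglyMeasurable]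

theorem iIndepFun_transmittedLaw {H : Type*} [MeasurableSpace H]
    {φ : EuclideanSpace ℝ (Fin n) → H} (hφ : Measurable φ) :
    iIndepFun (fun (m : Fin M) (g : Fin M → EuclideanSpace ℝ (Fin n)) => φ (g m))
      (transmittedLaw u s) :=
  iIndepFun_pi (X := fun _ => φ) fun _ => hφ.aemeasurable

theorem measure_abs_sum_inner_sub_ge_le (hn : 0 < n) (hu : ‖u‖ = 1) {c : ℝ} (hc : 0 < c) :
    transmittedLaw u s {g | c ≤ |∑ m ∈ s, inner ℝ u (normalizedDirection (g m)) -
        s.card * ∫ x, inner ℝ u (normalizedDirection x) ∂(hemisphereGaussian u)|}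
      ≤ ENNReal.ofReal (s.card * (n : ℝ)⁻¹ / c ^ 2) := by
  have hL2 : ∀ m ∈ s, MemLp (fun g : Fin M → EuclideanSpace ℝ (Fin n) =>
      inner ℝ u (normalizedDirection (g m))) 2 (transmittedLaw u s) := fun m _ =>
    MemLp.of_bound (Measurable.aestronglyMeasurable (by fun_prop)) ‖u‖
      (ae_of_all _ fun g => abs_inner_normalizedDirection_le u _)
  have hmean : (transmittedLaw u s)[∑ m ∈ s, fun g => inner ℝ u (normalizedDirection (g m))]
      = s.card * ∫ x, inner ℝ u (normalizedDirection x) ∂(hemisphereGaussian u) := by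
    simp only [Finset.sum_apply]
    rw [integral_finsetSum _ fun m hm => (hL2 m hm).integrable (by norm_num),
      Finset.sum_congr rfl fun m hm => integral_eval_transmittedLaw
        (φ := fun x => inner ℝ u (normalizedDirection x))
        (Measurable.stronglyMeasurable (by fun_prop)) hm]
    simp
  have hvar : Var[∑ m ∈ s, fun g => inner ℝ u (normalizedDirection (g m)); transmittedLaw u s]
      ≤ s.card * (n : ℝ)⁻¹ := by
    rw [IndepFun.variance_sum hL2 fun i _ j _ hij =>
      (iIndepFun_transmittedLaw (φ := fun x => inner ℝ u (normalizedDirection x))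
        (by fun_prop)).indepFun hij]
    rw [← nsmul_eq_mul]
    refine Finset.sum_le_card_nsmul _ _ _ fun m hm => ?_
    refine (variance_le_expectation_sq (Measurable.aestronglyMeasurable (by fun_prop))).trans ?_
    have := integral_eval_transmittedLaw (u := u)
        (φ := fun x => inner ℝ u (normalizedDirection x) ^ 2)
        (Measurable.stronglyMeasurable (by fun_prop)) hm
    simp only [Pi.pow_apply]
    rw [this]
    simpa [hu] using integral_inner_normalizedDirection_sq_hemisphereGaussian_le (u := u) hn u
  have h := meas_ge_le_variance_div_sq (memLp_finsetSum' s hL2) hc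
  rw [hmean] at h
  simp only [Finset.sum_apply] at h
  exact h.trans (ENNReal.ofReal_le_ofReal (by gcongr))

theorem measure_sum_inner_sq_ge_le (hn : 0 < n) (hu : ‖u‖ = 1) {c : ℝ} (hc : 0 < c) :
    transmittedLaw u s {g | c ≤ ∑ m ∈ s, inner ℝ u (normalizedDirection (g m)) ^ 2}
      ≤ ENNReal.ofReal (s.card * (n : ℝ)⁻¹ / c) := by
  have hi : ∀ m ∈ s, Integrable (fun g : Fin M → EuclideanSpace ℝ (Fin n) =>
      inner ℝ u (normalizedDirection (g m)) ^ 2) (transmittedLaw u s) := fun m _ => by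
    refine integrable_of_abs_le (by fun_prop) (C := ‖u‖ ^ 2) fun g => ?_
    rw [abs_pow]
    exact pow_le_pow_left₀ (abs_nonneg _) (abs_inner_normalizedDirection_le u _) 2
  refine measure_ge_le_ofReal_div (fun g => Finset.sum_nonneg fun m _ => sq_nonneg _)
    (integrable_finsetSum s hi) ?_ hc
  rw [integral_finsetSum _ hi, ← nsmul_eq_mul]
  refine Finset.sum_le_card_nsmul _ _ _ fun m hm => ?_
  have := integral_eval_transmittedLaw (u := u)
      (φ := fun x => inner ℝ u (normalizedDirection x) ^ 2)
      (Measurable.stronglyMeasurable (by fun_prop)) hm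
  rw [this]
  simpa [hu] using integral_inner_normalizedDirection_sq_hemisphereGaussian_le (u := u) hn u

/-- The component of the direction of `g` orthogonal to the unit vector `u`. -/
noncomputable def orthogonalDirection (u g : EuclideanSpace ℝ (Fin n)) :
    EuclideanSpace ℝ (Fin n) :=
  normalizedDirection g - inner ℝ u (normalizedDirection g) • u

@[fun_prop]
theorem measurable_orthogonalDirection (u : EuclideanSpace ℝ (Fin n)) :
    Measurable (orthogonalDirection u) := by
  unfold orthogonalDirection
  fun_prop

theorem norm_sub_inner_smul_sq (hu : ‖u‖ = 1) (x : EuclideanSpace ℝ (Fin n)) :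
    ‖x - inner ℝ u x • u‖ ^ 2 = ‖x‖ ^ 2 - inner ℝ u x ^ 2 := by
  rw [norm_sub_sq_real, real_inner_smul_right, norm_smul, hu, mul_one, Real.norm_eq_abs, sq_abs,
    real_inner_comm]
  ring

theorem norm_orthogonalDirection_le (hu : ‖u‖ = 1) (g : EuclideanSpace ℝ (Fin n)) :
    ‖orthogonalDirection u g‖ ≤ 1 := by
  have h := norm_sub_inner_smul_sq hu (normalizedDirection g)
  have h1 := pow_le_one₀ (n := 2) (norm_nonneg _) (norm_normalizedDirection_le g)
  rw [orthogonalDirection, ← abs_norm, ← sq_le_one_iff_abs_le_one, h]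
  nlinarith [sq_nonneg (inner ℝ u (normalizedDirection g))]

/-- Chebyshev for the cross terms, with `κ = 1/n`: pairing `v` with an orthogonal part is pairing
the projection of `v` with the direction itself, and projecting does not increase the norm. -/
theorem measure_abs_norm_sum_sq_sub_ge_le (hn : 0 < n) (hu : ‖u‖ = 1) {c : ℝ} (hc : 0 < c) :
    transmittedLaw u s {g | c ≤ |‖∑ m ∈ s, orthogonalDirection u (g m)‖ ^ 2 -
        ∑ m ∈ s, ‖orthogonalDirection u (g m)‖ ^ 2|}
      ≤ ENNReal.ofReal (2 * (n : ℝ)⁻¹ * (s.card : ℝ) ^ 2 / c ^ 2) := by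
  have hb : ∀ (m : Fin M) (g : Fin M → EuclideanSpace ℝ (Fin n)),
      ‖orthogonalDirection u (g m)‖ ≤ 1 := fun m g => norm_orthogonalDirection_le hu _
  refine measure_abs_ge_le_ofReal_div_sq ?_ (integral_norm_sum_sq_sub_sq_le
    (a := fun (m : Fin M) (g : Fin M → EuclideanSpace ℝ (Fin n)) => orthogonalDirection u (g m))
    (iIndepFun_transmittedLaw (by fun_prop)) (fun m => by fun_prop) hb s (fun m hm => ?_)
    (by positivity) fun m hm v => ?_) hc
  · refine integrable_of_abs_le (by fun_prop) (C := ((s.card : ℝ) ^ 2 + s.card) ^ 2) fun g => ?_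
    rw [abs_pow]
    refine pow_le_pow_left₀ (abs_nonneg _) ((abs_sub _ _).trans (add_le_add ?_ ?_)) 2
    · rw [abs_pow, abs_norm]
      exact pow_le_pow_left₀ (norm_nonneg _) (norm_sum_le_card hb s g) 2
    · rw [abs_of_nonneg (Finset.sum_nonneg fun m _ => sq_nonneg _)]
      simpa using Finset.sum_le_sum (s := s) fun m _ =>
        pow_le_one₀ (n := 2) (norm_nonneg _) (hb m g)
  · rw [integral_eval_transmittedLaw (φ := orthogonalDirection u)
      (Measurable.stronglyMeasurable (by fun_prop)) hm]
    exact integral_orthogonal_normalizedDirection_hemisphereGaussian hu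
  · have := integral_eval_transmittedLaw (u := u)
      (φ := fun x => inner ℝ v (orthogonalDirection u x) ^ 2)
      (Measurable.stronglyMeasurable (by fun_prop)) hm
    rw [this]
    have e : ∀ x, inner ℝ v (orthogonalDirection u x)
        = inner ℝ (v - inner ℝ u v • u) (normalizedDirection x) := fun x => by
      rw [orthogonalDirection, inner_sub_right, inner_sub_left, real_inner_smul_right,
        real_inner_smul_left, real_inner_comm u v]
      ring
    simp_rw [e]
    refine (integral_inner_normalizedDirection_sq_hemisphereGaussian_le hn _).trans ?_
    rw [norm_sub_inner_smul_sq hu]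
    refine mul_le_mul_of_nonneg_left ?_ (by positivity)
    linarith [sq_nonneg (inner ℝ u v)]

theorem measure_norm_stdGaussian_ge_le {c : ℝ} (hc : 0 < c) :
    stdGaussian (EuclideanSpace ℝ (Fin n)) {z | c ≤ ‖z‖} ≤ ENNReal.ofReal (n / c ^ 2) := by
  simpa using measure_abs_ge_le_ofReal_div_sq (f := fun z : EuclideanSpace ℝ (Fin n) => ‖z‖)
    integrable_norm_sq_stdGaussian integral_norm_sq_stdGaussian.le hc

end TransmittedLaw

/-! ### From concentration to the error of the estimated axis. -/

section DirectionError

variable {n M : ℕ} {u : EuclideanSpace ℝ (Fin n)} {s : Finset (Fin M)}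

theorem sphericalCodeword_eq_smul_normalizedDirection (P : ℝ) (g : EuclideanSpace ℝ (Fin n)) :
    sphericalCodeword P g = Real.sqrt (n * P) • normalizedDirection g :=
  rfl

theorem measurable_channelOutput (P : ℝ) (s : Finset (Fin M)) :
    Measurable fun p : (Fin M → EuclideanSpace ℝ (Fin n)) × EuclideanSpace ℝ (Fin n) =>
      channelOutput P p.1 s p.2 := by
  simp only [channelOutput, sphericalCodeword_eq_smul_normalizedDirection]
  fun_prop

theorem inner_normalizedDirection_eq_div (hn : 0 < n) (y : EuclideanSpace ℝ (Fin n)) :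
    inner ℝ u (normalizedDirection y) = (inner ℝ u y / n) / (‖y‖ / n) := by
  have hn' : (n : ℝ) ≠ 0 := by exact_mod_cast hn.ne'
  rw [normalizedDirection, real_inner_smul_right, div_div_div_cancel_right₀ hn', inv_mul_eq_div]

theorem sqrt_natCast_mul_div_eq (hn : 0 < n) (P : ℝ) :
    Real.sqrt (n * P) / n = Real.sqrt P / Real.sqrt n := by
  have hn' : 0 < Real.sqrt n := Real.sqrt_pos.2 (by exact_mod_cast hn)
  rw [Real.sqrt_mul (Nat.cast_nonneg n)]
  nth_rewrite 2 [← Real.mul_self_sqrt (Nat.cast_nonneg (α := ℝ) n)]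
  field_simp

/-- The deterministic half of the argument: off the bad events, the normalized correlation is
exactly the perturbed ratio controlled by `hη`. -/
theorem abs_inner_channelOutput_sub_lt {β P ε η α : ℝ} (hn : 0 < n) (hP : 0 < P) (hu : ‖u‖ = 1)
    (hη : ∀ k l a b d e f : ℝ,
      |k - β * (Real.sqrt P * Real.sqrt (2 / Real.pi))| < η → |l - P * β| < η →
      |a| < η → |b| < η → |d| < η → |e| < η → |f| < η →
      |(k + a + e) / (Real.sqrt ((k + a) ^ 2 + b + l - d) + f)
        - Real.sqrt (2 * β / (2 * β + Real.pi))| < ε)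
    (hk : |Real.sqrt P / Real.sqrt n * (s.card * α)
      - β * (Real.sqrt P * Real.sqrt (2 / Real.pi))| < η)
    (hl : |P * (s.card / n) - P * β| < η)
    (g : Fin M → EuclideanSpace ℝ (Fin n)) (z : EuclideanSpace ℝ (Fin n))
    (hg : ∀ m ∈ s, g m ≠ 0)
    (ha : |∑ m ∈ s, inner ℝ u (normalizedDirection (g m)) - s.card * α|
      < η / (Real.sqrt P / Real.sqrt n))
    (hb : |‖∑ m ∈ s, orthogonalDirection u (g m)‖ ^ 2 -
        ∑ m ∈ s, ‖orthogonalDirection u (g m)‖ ^ 2| < η / (P / n))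
    (hd : ∑ m ∈ s, inner ℝ u (normalizedDirection (g m)) ^ 2 < η / (P / n))
    (hz : ‖z‖ < η * n) :
    |inner ℝ u (normalizedDirection (channelOutput P g s z))
      - Real.sqrt (2 * β / (2 * β + Real.pi))| < ε := by
  have hn' : (0 : ℝ) < n := by exact_mod_cast hn
  have hsn : 0 < Real.sqrt n := Real.sqrt_pos.2 hn'
  have hsP : 0 < Real.sqrt P := Real.sqrt_pos.2 hP
  have ht2 : (Real.sqrt P / Real.sqrt n) ^ 2 = P / n := by
    rw [div_pow, Real.sq_sqrt hP.le, Real.sq_sqrt hn'.le]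
  have ht0 : 0 < Real.sqrt P / Real.sqrt n := by positivity
  set t := Real.sqrt P / Real.sqrt n with ht
  have htn : Real.sqrt (n * P) = t * n := by
    rw [ht, ← sqrt_natCast_mul_div_eq hn, div_mul_cancel₀ _ hn'.ne']
  set T := ∑ m ∈ s, normalizedDirection (g m) with hT
  set A := ∑ m ∈ s, inner ℝ u (normalizedDirection (g m)) with hA
  set D := ∑ m ∈ s, inner ℝ u (normalizedDirection (g m)) ^ 2 with hD
  set W := ‖∑ m ∈ s, orthogonalDirection u (g m)‖ ^ 2 -
        ∑ m ∈ s, ‖orthogonalDirection u (g m)‖ ^ 2 with hW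
  have hAT : inner ℝ u T = A := by rw [hT, inner_sum]
  have hY : channelOutput P g s z = (t * n) • T + z := by
    simp only [channelOutput, sphericalCodeword_eq_smul_normalizedDirection]
    rw [← Finset.smul_sum, htn]
  -- Pythagoras along `u`. The term `s.card - D` needs every direction to have norm exactly `1`,
  -- which is where `hg` enters.
  have hTsq : ‖T‖ ^ 2 = A ^ 2 + W + s.card - D := by
    have h1 : ∑ m ∈ s, orthogonalDirection u (g m) = T - inner ℝ u T • u := by
      simp only [orthogonalDirection]
      rw [Finset.sum_sub_distrib, ← Finset.sum_smul, hAT]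
    have h2 : ∑ m ∈ s, ‖orthogonalDirection u (g m)‖ ^ 2 = s.card - D := by
      rw [Finset.sum_congr rfl fun m hm => by
        rw [orthogonalDirection, norm_sub_inner_smul_sq hu, norm_normalizedDirection (hg m hm)],
        Finset.sum_sub_distrib]
      simp [hD]
    rw [hW, h1, h2, norm_sub_inner_smul_sq hu, hAT]
    ring
  have hD0 : 0 ≤ D := Finset.sum_nonneg fun m _ => sq_nonneg _
  have hmain := hη (t * (s.card * α)) (P * (s.card / n)) (t * (A - s.card * α)) (P / n * W)
    (P / n * D) (inner ℝ u z / n) (‖channelOutput P g s z‖ / n - t * ‖T‖) hk hl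
    (by rwa [abs_mul, abs_of_pos ht0, ← lt_div_iff₀' ht0])
    (by rwa [abs_mul, abs_of_pos (show 0 < P / n by positivity), ← lt_div_iff₀' (by positivity)])
    (by rwa [abs_mul, abs_of_pos (show 0 < P / n by positivity), abs_of_nonneg hD0,
      ← lt_div_iff₀' (by positivity)])
    (by
      rw [abs_div, abs_of_pos hn', div_lt_iff₀ hn']
      have := abs_real_inner_le_norm u z
      rw [hu, one_mul] at this
      exact this.trans_lt hz)
    -- The denominator error is bounded by the reverse triangle inequality: `‖Y‖` and the norm of
    -- the noiseless signal differ by at most `‖z‖`.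
    (by
      have h1 : t * ‖T‖ = ‖(t * n) • T‖ / n := by
        rw [norm_smul, Real.norm_of_nonneg (by positivity)]
        field_simp
      rw [h1, ← sub_div, abs_div, abs_of_pos hn', div_lt_iff₀ hn', hY]
      refine (abs_norm_sub_norm_le _ _).trans_lt ?_
      rwa [add_sub_cancel_left])
  have hnum : t * (s.card * α) + t * (A - s.card * α) + inner ℝ u z / n
      = inner ℝ u (channelOutput P g s z) / n := by
    rw [hY, inner_add_right, real_inner_smul_right, hAT]
    field_simp
    ring
  have hden : Real.sqrt ((t * (s.card * α) + t * (A - s.card * α)) ^ 2 + P / n * W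
      + P * (s.card / n) - P / n * D) = t * ‖T‖ := by
    rw [show (t * (s.card * α) + t * (A - s.card * α)) ^ 2 + P / n * W
      + P * (s.card / n) - P / n * D = (t * ‖T‖) ^ 2 by
        rw [mul_pow, hTsq, ← ht2, show P * (s.card / n) = t ^ 2 * s.card by rw [ht2]; ring]
        ring]
    exact Real.sqrt_sq (by positivity)
  rw [hnum, hden, add_sub_cancel] at hmain
  rwa [inner_normalizedDirection_eq_div hn]

/-- Union bound over the bad events. The four terms of the numerator come from the signal
fluctuation, the cross terms, the squared components along `u`, and the noise; the bound depends on
`s` only through its cardinality. -/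
theorem measure_abs_inner_channelOutput_sub_ge_le {β P ε η : ℝ} (hn : 0 < n) (hP : 0 < P)
    (hu : ‖u‖ = 1) (hη0 : 0 < η)
    (hη : ∀ k l a b d e f : ℝ,
      |k - β * (Real.sqrt P * Real.sqrt (2 / Real.pi))| < η → |l - P * β| < η →
      |a| < η → |b| < η → |d| < η → |e| < η → |f| < η →
      |(k + a + e) / (Real.sqrt ((k + a) ^ 2 + b + l - d) + f)
        - Real.sqrt (2 * β / (2 * β + Real.pi))| < ε)
    (hk : |Real.sqrt P / Real.sqrt n *
        (s.card * ∫ x, inner ℝ u (normalizedDirection x) ∂(hemisphereGaussian u))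
      - β * (Real.sqrt P * Real.sqrt (2 / Real.pi))| < η)
    (hl : |P * (s.card / n) - P * β| < η) :
    ((transmittedLaw u s).prod (stdGaussian (EuclideanSpace ℝ (Fin n))))
      {p | ε ≤ |inner ℝ u (normalizedDirection (channelOutput P p.1 s p.2))
        - Real.sqrt (2 * β / (2 * β + Real.pi))|}
      ≤ ENNReal.ofReal ((P * (s.card / n) + 2 * (P * (s.card / n)) ^ 2 + P * (s.card / n) * η + 1)
          / (n * η ^ 2)) := by
  have hn' : (0 : ℝ) < n := by exact_mod_cast hn
  have hsn : 0 < Real.sqrt n := Real.sqrt_pos.2 hn'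
  have hsP : 0 < Real.sqrt P := Real.sqrt_pos.2 hP
  set α := ∫ x, inner ℝ u (normalizedDirection x) ∂(hemisphereGaussian u) with hα
  set γ := stdGaussian (EuclideanSpace ℝ (Fin n)) with hγ
  set A := {g : Fin M → EuclideanSpace ℝ (Fin n) | η / (Real.sqrt P / Real.sqrt n) ≤
    |∑ m ∈ s, inner ℝ u (normalizedDirection (g m)) - s.card * α|} with hA
  set B := {g : Fin M → EuclideanSpace ℝ (Fin n) | η / (P / n) ≤
    |‖∑ m ∈ s, orthogonalDirection u (g m)‖ ^ 2 -
        ∑ m ∈ s, ‖orthogonalDirection u (g m)‖ ^ 2|} with hB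
  set D := {g : Fin M → EuclideanSpace ℝ (Fin n) | η / (P / n) ≤
    ∑ m ∈ s, inner ℝ u (normalizedDirection (g m)) ^ 2} with hD
  set C := {z : EuclideanSpace ℝ (Fin n) | η * n ≤ ‖z‖} with hC
  set N := {g : Fin M → EuclideanSpace ℝ (Fin n) | ¬ ∀ m ∈ s, g m ≠ 0} with hN
  have hNnull : transmittedLaw u s N = 0 := by
    rw [hN, ← ae_iff]
    refine (Finset.eventually_all s).2 fun m hm => ?_
    exact (measurePreserving_eval_transmittedLaw hm).quasiMeasurePreserving.ae
      (ae_ne_zero_hemisphereGaussian hu)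
  have hsub : {p : (Fin M → EuclideanSpace ℝ (Fin n)) × EuclideanSpace ℝ (Fin n) |
      ε ≤ |inner ℝ u (normalizedDirection (channelOutput P p.1 s p.2))
        - Real.sqrt (2 * β / (2 * β + Real.pi))|}
      ⊆ (((A ∪ B) ∪ D) ∪ N) ×ˢ Set.univ ∪ Set.univ ×ˢ C := by
    rintro ⟨g, z⟩ hp
    by_contra hcon
    simp only [Set.mem_union, Set.mem_prod, Set.mem_univ, and_true, true_and, not_or] at hcon
    obtain ⟨⟨⟨⟨h1, h2⟩, h3⟩, h4⟩, h5⟩ := hcon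
    exact absurd (abs_inner_channelOutput_sub_lt hn hP hu hη hk hl g z (not_not.1 h4)
      (not_le.1 h1) (not_le.1 h2) (not_le.1 h3) (not_le.1 h5)) (not_lt.2 hp)
  have hbA := measure_abs_sum_inner_sub_ge_le (s := s) hn hu
    (show 0 < η / (Real.sqrt P / Real.sqrt n) by positivity)
  have hbB := measure_abs_norm_sum_sq_sub_ge_le (s := s) hn hu (show 0 < η / (P / n) by positivity)
  have hbD := measure_sum_inner_sq_ge_le (s := s) hn hu (show 0 < η / (P / n) by positivity)
  have hbC := measure_norm_stdGaussian_ge_le (n := n) (show 0 < η * n by positivity)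
  calc _ ≤ ((transmittedLaw u s).prod γ)
        ((((A ∪ B) ∪ D) ∪ N) ×ˢ Set.univ ∪ Set.univ ×ˢ C) := measure_mono hsub
    _ ≤ (((transmittedLaw u s A + transmittedLaw u s B) + transmittedLaw u s D)
          + transmittedLaw u s N) + γ C := by
        refine (measure_union_le _ _).trans ?_
        rw [Measure.prod_prod, Measure.prod_prod, measure_univ, measure_univ, mul_one, one_mul]
        gcongr
        refine (measure_union_le _ _).trans ?_
        gcongr
        refine (measure_union_le _ _).trans ?_
        gcongr
        exact measure_union_le _ _
    _ ≤ _ := by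
        rw [hNnull, add_zero]
        refine (add_le_add (add_le_add (add_le_add hbA hbB) hbD) hbC).trans ?_
        rw [← ENNReal.ofReal_add (by positivity) (by positivity),
          ← ENNReal.ofReal_add (by positivity) (by positivity),
          ← ENNReal.ofReal_add (by positivity) (by positivity)]
        refine ENNReal.ofReal_le_ofReal (le_of_eq ?_)
        rw [div_pow η, div_pow (Real.sqrt P), Real.sq_sqrt hP.le, Real.sq_sqrt hn'.le]
        field_simp

end DirectionError

/-! ### Conditioning on the hemisphere event and averaging over the transmitted set. -/

section Model

variable {n M K : ℕ} {Ω : Type*} {X : Fin M → Ω → EuclideanSpace ℝ (Fin n)}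
  {S : Ω → Finset (Fin M)} {Z : Ω → EuclideanSpace ℝ (Fin n)} {u : EuclideanSpace ℝ (Fin n)}

/-- The vectors generating the codebook for which the codewords indexed by `s` lie in the
hemisphere with axis `u`. -/
def hemisphereVectors (u : EuclideanSpace ℝ (Fin n)) (s : Finset (Fin M)) :
    Set (Fin M → EuclideanSpace ℝ (Fin n)) :=
  Set.univ.pi fun m => if m ∈ s then {g | g ≠ 0 ∧ 0 ≤ inner ℝ g u} else Set.univ

theorem mem_hemisphereVectors {s : Finset (Fin M)} {g : Fin M → EuclideanSpace ℝ (Fin n)} :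
    g ∈ hemisphereVectors u s ↔ ∀ m ∈ s, g m ≠ 0 ∧ 0 ≤ inner ℝ (g m) u := by
  simp only [hemisphereVectors, Set.mem_univ_pi]
  refine forall_congr' fun m => ?_
  by_cases hm : m ∈ s <;> simp [hm]

theorem measurableSet_hemisphereVectors (u : EuclideanSpace ℝ (Fin n)) (s : Finset (Fin M)) :
    MeasurableSet (hemisphereVectors u s) := by
  refine MeasurableSet.univ_pi fun m => ?_
  split_ifs
  · exact measurableSet_ne_zero_inner_nonneg u
  · exact MeasurableSet.univ

/-- Restricting a product measure to a box restricts each factor, and each transmitted coordinate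
contributes a factor `1/2`. -/
theorem pi_stdGaussian_restrict_hemisphereVectors (hu : ‖u‖ = 1) (s : Finset (Fin M)) :
    (Measure.pi fun _ : Fin M => stdGaussian (EuclideanSpace ℝ (Fin n))).restrict
        (hemisphereVectors u s)
      = ((2 : ENNReal)⁻¹ ^ s.card) • transmittedLaw u s := by
  rw [hemisphereVectors, Measure.restrict_pi_pi]
  refine Measure.pi_eq fun A hA => ?_
  rw [Measure.smul_apply, transmittedLaw, Measure.pi_pi, smul_eq_mul]
  have h : ∀ m, (stdGaussian (EuclideanSpace ℝ (Fin n))).restrict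
      (if m ∈ s then {g | g ≠ 0 ∧ 0 ≤ inner ℝ g u} else Set.univ) (A m)
      = (if m ∈ s then (2 : ENNReal)⁻¹ else 1) *
        (if m ∈ s then hemisphereGaussian u else stdGaussian (EuclideanSpace ℝ (Fin n))) (A m) := by
    intro m
    split_ifs
    · rw [stdGaussian_restrict_hemisphere hu, Measure.smul_apply, smul_eq_mul]
    · rw [Measure.restrict_univ, one_mul]
  simp_rw [h]
  rw [Finset.prod_mul_distrib, Finset.prod_ite_mem, Finset.univ_inter, Finset.prod_const]

theorem prod_stdGaussian_inter_hemisphereVectors (hu : ‖u‖ = 1) (s : Finset (Fin M))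
    {B : Set ((Fin M → EuclideanSpace ℝ (Fin n)) × EuclideanSpace ℝ (Fin n))}
    (hB : MeasurableSet B) :
    ((Measure.pi fun _ : Fin M => stdGaussian (EuclideanSpace ℝ (Fin n))).prod
        (stdGaussian (EuclideanSpace ℝ (Fin n)))) (B ∩ hemisphereVectors u s ×ˢ Set.univ)
      = (2 : ENNReal)⁻¹ ^ s.card *
        ((transmittedLaw u s).prod (stdGaussian (EuclideanSpace ℝ (Fin n)))) B := by
  rw [← Measure.restrict_apply hB, ← Measure.restrict_prod_eq_prod_univ,
    pi_stdGaussian_restrict_hemisphereVectors hu, Measure.prod_smul_left, Measure.smul_apply,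
    smul_eq_mul]

/-- The condition `g ≠ 0` built into `hemisphereVectors` matches the requirement of unit norm: a
zero generator yields the zero codeword, which is not on the sphere. -/
theorem transmittedInHemisphere_eq {P : ℝ} (hn : 0 < n) (hP : 0 < P) :
    transmittedInHemisphere P X S u
      = {ω | ((fun m => X m ω), Z ω) ∈ hemisphereVectors u (S ω) ×ˢ Set.univ} := by
  have hnP : Real.sqrt (n * P) ≠ 0 := by
    have : (0 : ℝ) < n := by exact_mod_cast hn
    positivity
  ext ω
  simp only [transmittedInHemisphere, Set.mem_prod, Set.mem_univ, and_true,
    Set.mem_ofPred_eq, mem_hemisphereVectors, unitHemisphere,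
    sphericalCodeword_eq_smul_normalizedDirection, inv_smul_smul₀ hnP, mem_sphere_zero_iff_norm]
  refine forall₂_congr fun m _ => ?_
  rcases eq_or_ne (X m ω) 0 with h | h
  · simp [h, normalizedDirection]
  · rw [norm_normalizedDirection h, normalizedDirection, real_inner_smul_left,
      mul_nonneg_iff_of_pos_left (by positivity)]
    simp [h]

theorem setOf_mem_eq_iUnion
    (A : Finset (Fin M) → Set ((Fin M → EuclideanSpace ℝ (Fin n)) × EuclideanSpace ℝ (Fin n))) :
    {ω | ((fun m => X m ω), Z ω) ∈ A (S ω)}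
      = ⋃ s, S ⁻¹' {s} ∩ (fun ω => ((fun m => X m ω), Z ω)) ⁻¹' A s := by
  ext ω
  simp

variable [MeasurableSpace Ω] {μ : Measure Ω}

theorem IsManyAccessModel.aemeasurable_prod (h : IsManyAccessModel K μ X S Z) :
    AEMeasurable (fun ω => ((fun m => X m ω), Z ω)) μ :=
  (aemeasurable_pi_lambda _ fun m => (h.law_X m).aemeasurable).prodMk h.law_Z.aemeasurable

theorem IsManyAccessModel.measure_preimage_eq_zero (h : IsManyAccessModel K μ X S Z)
    {s : Finset (Fin M)} (hs : s.card ≠ K) : μ (S ⁻¹' {s}) = 0 := by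
  have : S ⁻¹' {s} = ∅ := by
    ext ω
    simp only [Set.mem_preimage, Set.mem_singleton_iff, Set.mem_empty_iff_false, iff_false]
    rintro rfl
    exact hs (h.card_S ω)
  rw [this, measure_empty]

/-- `HasLaw` provides only a.e. measurability of the generators and the noise, so events are handled
as null measurable sets. -/
theorem IsManyAccessModel.nullMeasurableSet_inter (h : IsManyAccessModel K μ X S Z)
    {A : Set ((Fin M → EuclideanSpace ℝ (Fin n)) × EuclideanSpace ℝ (Fin n))}
    (hA : MeasurableSet A) (s : Finset (Fin M)) :
    NullMeasurableSet (S ⁻¹' {s} ∩ (fun ω => ((fun m => X m ω), Z ω)) ⁻¹' A) μ :=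
  (h.measurable_S (measurableSet_singleton s)).nullMeasurableSet.inter
    (h.aemeasurable_prod.nullMeasurable hA)

variable [IsProbabilityMeasure μ]

theorem IsManyAccessModel.map_prod (h : IsManyAccessModel K μ X S Z) :
    μ.map (fun ω => ((fun m => X m ω), Z ω))
      = (Measure.pi fun _ : Fin M => stdGaussian (EuclideanSpace ℝ (Fin n))).prod
        (stdGaussian (EuclideanSpace ℝ (Fin n))) := by
  have hX : AEMeasurable (fun ω m => X m ω) μ :=
    aemeasurable_pi_lambda _ fun m => (h.law_X m).aemeasurable
  rw [(indepFun_iff_map_prod_eq_prod_map_map hX h.law_Z.aemeasurable).1 h.indep_Z,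
    (iIndepFun_iff_map_fun_eq_pi_map fun m => (h.law_X m).aemeasurable).1 h.indep_X, h.law_Z.map_eq]
  simp_rw [fun m => (h.law_X m).map_eq]

theorem IsManyAccessModel.measure_eq_sum (h : IsManyAccessModel K μ X S Z)
    {A : Finset (Fin M) → Set ((Fin M → EuclideanSpace ℝ (Fin n)) × EuclideanSpace ℝ (Fin n))}
    (hA : ∀ s, MeasurableSet (A s)) :
    μ {ω | ((fun m => X m ω), Z ω) ∈ A (S ω)}
      = ∑ s, μ (S ⁻¹' {s}) * ((Measure.pi fun _ : Fin M =>
        stdGaussian (EuclideanSpace ℝ (Fin n))).prod (stdGaussian (EuclideanSpace ℝ (Fin n)))) (A s) := by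
  rw [setOf_mem_eq_iUnion, measure_iUnion₀ _ fun s => h.nullMeasurableSet_inter (hA s) s,
    tsum_fintype]
  · refine Finset.sum_congr rfl fun s _ => ?_
    rw [h.indep_S.measure_inter_preimage_eq_mul _ _ (measurableSet_singleton s) (hA s), ← h.map_prod,
      Measure.map_apply_of_aemeasurable h.aemeasurable_prod (hA s)]
  · intro s t hst
    refine Disjoint.aedisjoint ?_
    exact ((Set.disjoint_singleton.2 hst).preimage S).mono Set.inter_subset_left Set.inter_subset_left

theorem IsManyAccessModel.sum_measure_preimage (h : IsManyAccessModel K μ X S Z) :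
    ∑ s, μ (S ⁻¹' {s}) = 1 := by
  have := h.measure_eq_sum (A := fun _ => Set.univ) fun _ => MeasurableSet.univ
  simpa using this.symm

theorem IsManyAccessModel.measure_inter_transmittedInHemisphere (h : IsManyAccessModel K μ X S Z)
    {P : ℝ} (hn : 0 < n) (hP : 0 < P) (hu : ‖u‖ = 1)
    {B : Finset (Fin M) → Set ((Fin M → EuclideanSpace ℝ (Fin n)) × EuclideanSpace ℝ (Fin n))}
    (hB : ∀ s, MeasurableSet (B s)) :
    μ ({ω | ((fun m => X m ω), Z ω) ∈ B (S ω)} ∩ transmittedInHemisphere P X S u)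
      = (2 : ENNReal)⁻¹ ^ K * ∑ s, μ (S ⁻¹' {s}) *
        ((transmittedLaw u s).prod (stdGaussian (EuclideanSpace ℝ (Fin n)))) (B s) := by
  rw [transmittedInHemisphere_eq (Z := Z) hn hP]
  have := h.measure_eq_sum (A := fun s => B s ∩ hemisphereVectors u s ×ˢ Set.univ)
    fun s => (hB s).inter ((measurableSet_hemisphereVectors u s).prod MeasurableSet.univ)
  refine Eq.trans this ?_
  rw [Finset.mul_sum]
  refine Finset.sum_congr rfl fun s _ => ?_
  by_cases hs : s.card = K
  · rw [prod_stdGaussian_inter_hemisphereVectors hu s (hB s), hs]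
    ring
  · simp [h.measure_preimage_eq_zero hs]

theorem IsManyAccessModel.measure_transmittedInHemisphere (h : IsManyAccessModel K μ X S Z)
    {P : ℝ} (hn : 0 < n) (hP : 0 < P) (hu : ‖u‖ = 1) :
    μ (transmittedInHemisphere P X S u) = (2 : ENNReal)⁻¹ ^ K := by
  have := h.measure_inter_transmittedInHemisphere hn hP hu (B := fun _ => Set.univ)
    fun _ => MeasurableSet.univ
  simpa [h.sum_measure_preimage] using this

theorem IsManyAccessModel.nullMeasurableSet_transmittedInHemisphere
    (h : IsManyAccessModel K μ X S Z) {P : ℝ} (hn : 0 < n) (hP : 0 < P) :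
    NullMeasurableSet (transmittedInHemisphere P X S u) μ := by
  rw [transmittedInHemisphere_eq (Z := Z) hn hP,
    setOf_mem_eq_iUnion (fun s => hemisphereVectors u s ×ˢ Set.univ)]
  exact NullMeasurableSet.iUnion fun s => h.nullMeasurableSet_inter
    ((measurableSet_hemisphereVectors u s).prod MeasurableSet.univ) s

/-- The factor `2⁻ᴷ` is common to all sets of size `K`, so it cancels and conditioning does not bias
the law of `S`. A bound uniform in `s` survives the averaging. -/
theorem IsManyAccessModel.cond_transmittedInHemisphere_le (h : IsManyAccessModel K μ X S Z)
    {P : ℝ} (hn : 0 < n) (hP : 0 < P) (hu : ‖u‖ = 1)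
    {B : Finset (Fin M) → Set ((Fin M → EuclideanSpace ℝ (Fin n)) × EuclideanSpace ℝ (Fin n))}
    (hB : ∀ s, MeasurableSet (B s)) {δ : ENNReal}
    (hδ : ∀ s, s.card = K →
      ((transmittedLaw u s).prod (stdGaussian (EuclideanSpace ℝ (Fin n)))) (B s) ≤ δ) :
    ProbabilityTheory.cond μ (transmittedInHemisphere P X S u)
      {ω | ((fun m => X m ω), Z ω) ∈ B (S ω)} ≤ δ := by
  rw [ProbabilityTheory.cond, Measure.smul_apply, smul_eq_mul,
    Measure.restrict_apply₀' (h.nullMeasurableSet_transmittedInHemisphere hn hP),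
    h.measure_inter_transmittedInHemisphere hn hP hu hB,
    h.measure_transmittedInHemisphere hn hP hu, ← mul_assoc,
    ENNReal.inv_mul_cancel (by simp) (by simp), one_mul]
  calc _ ≤ ∑ s, μ (S ⁻¹' {s}) * δ := by
        refine Finset.sum_le_sum fun s _ => ?_
        by_cases hs : s.card = K
        · gcongr
          exact hδ s hs
        · simp [h.measure_preimage_eq_zero hs]
    _ = δ := by rw [← Finset.sum_mul, h.sum_measure_preimage, one_mul]

end Model

/-! ### Passage to the limit in the blocklength. -/

theorem tendsto_sqrt_mul_integral_inner_hemisphereGaussian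
    {u : ∀ n : ℕ, EuclideanSpace ℝ (Fin n)} (hu : ∀ n, 1 ≤ n → ‖u n‖ = 1) :
    Tendsto (fun n : ℕ => Real.sqrt n *
      ∫ x, inner ℝ (u n) (normalizedDirection x) ∂(hemisphereGaussian (u n))) atTop
      (𝓝 (Real.sqrt (2 / Real.pi))) := by
  rw [tendsto_iff_dist_tendsto_zero]
  have hlim : Tendsto (fun n : ℕ => (1 + Var[fun x => x ^ 2; gaussianReal 0 1]) /
      (2 * Real.sqrt n)) atTop (𝓝 0) :=
    ((Real.tendsto_sqrt_atTop.comp tendsto_natCast_atTop_atTop).const_mul_atTop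
      two_pos).const_div_atTop _
  refine squeeze_zero' (Eventually.of_forall fun n => dist_nonneg) ?_ hlim
  filter_upwards [eventually_ge_atTop 1] with n hn
  rw [Real.dist_eq, integral_inner_normalizedDirection_hemisphereGaussian]
  exact abs_sqrt_mul_integral_abs_inner_sub_le hn (hu n hn)

theorem mainTheorem3 (β P d : ℝ) (hβ : 0 < β) (hP : 0 < P) (hd : 2 < d)
    (K : ℕ → ℕ) (hK : Tendsto (fun n : ℕ => (K n : ℝ) / n) atTop (𝓝 β))
    (Ω : ℕ → Type*) [∀ n, MeasurableSpace (Ω n)]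
    (μ : ∀ n, Measure (Ω n)) [∀ n, IsProbabilityMeasure (μ n)]
    (X : ∀ n : ℕ, Fin ⌊(n : ℝ) ^ d⌋₊ → Ω n → EuclideanSpace ℝ (Fin n))
    (S : ∀ n : ℕ, Ω n → Finset (Fin ⌊(n : ℝ) ^ d⌋₊))
    (Z : ∀ n : ℕ, Ω n → EuclideanSpace ℝ (Fin n))
    (hmodel : ∀ᶠ n in atTop, IsManyAccessModel (K n) (μ n) (X n) (S n) (Z n))
    (u : ∀ n : ℕ, EuclideanSpace ℝ (Fin n)) (hu : ∀ n, 1 ≤ n → ‖u n‖ = 1) :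
    (∀ᶠ n in atTop, 0 < μ n (transmittedInHemisphere P (X n) (S n) (u n))) ∧
    ∀ ε : ℝ, 0 < ε →
      Tendsto
        (fun n => ProbabilityTheory.cond (μ n) (transmittedInHemisphere P (X n) (S n) (u n))
          {ω | ε ≤ |inner ℝ (u n)
              (normalizedDirection (channelOutput P (fun m => X n m ω) (S n ω) (Z n ω))) -
            Real.sqrt (2 * β / (2 * β + Real.pi))|})
        atTop (𝓝 0) := by
  refine ⟨?_, fun ε hε => ?_⟩
  · filter_upwards [hmodel, eventually_ge_atTop 1] with n hn hn1
    rw [hn.measure_transmittedInHemisphere hn1 hP (hu n hn1)]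
    exact ENNReal.pow_pos (by simp) _
  obtain ⟨η, hη0, hη⟩ := exists_pos_forall_abs_ratio_sub_lt hβ hP hε
  have hl : Tendsto (fun n : ℕ => P * ((K n : ℝ) / n)) atTop (𝓝 (P * β)) := hK.const_mul P
  have hk : Tendsto (fun n : ℕ => Real.sqrt P / Real.sqrt n *
      (K n * ∫ x, inner ℝ (u n) (normalizedDirection x) ∂(hemisphereGaussian (u n)))) atTop
      (𝓝 (β * (Real.sqrt P * Real.sqrt (2 / Real.pi)))) := by
    refine (hK.mul ((tendsto_sqrt_mul_integral_inner_hemisphereGaussian hu).const_mul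
      (Real.sqrt P))).congr' ?_
    filter_upwards [eventually_ge_atTop 1] with n hn
    have hn' : 0 < Real.sqrt n := Real.sqrt_pos.2 (by exact_mod_cast hn)
    -- Writing `n = √n √n` splits `K/n` so that one `√n` cancels the normalization of the mean
    -- component and the other remains in `√P/√n`.
    nth_rewrite 1 [← Real.mul_self_sqrt (Nat.cast_nonneg (α := ℝ) n)]
    field_simp
  have hδ : Tendsto (fun n : ℕ => ENNReal.ofReal ((P * ((K n : ℝ) / n) +
      2 * (P * ((K n : ℝ) / n)) ^ 2 + P * ((K n : ℝ) / n) * η + 1) / (n * η ^ 2))) atTop (𝓝 0) := by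
    rw [← ENNReal.ofReal_zero]
    refine ENNReal.tendsto_ofReal ?_
    -- The numerator converges because `K/n` does, and the denominator is of order `n`.
    exact (((hl.add ((hl.pow 2).const_mul 2)).add (hl.mul_const η)).add_const 1).div_atTop
      (tendsto_natCast_atTop_atTop.atTop_mul_const (by positivity))
  refine tendsto_of_tendsto_of_tendsto_of_le_of_le' tendsto_const_nhds hδ
    (Eventually.of_forall fun n => zero_le) ?_
  filter_upwards [hmodel, eventually_ge_atTop 1, Metric.tendsto_nhds.1 hk η hη0,
    Metric.tendsto_nhds.1 hl η hη0] with n hn hn1 hkn hln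
  rw [Real.dist_eq] at hkn hln
  refine hn.cond_transmittedInHemisphere_le hn1 hP (hu n hn1)
    (B := fun s => {p | ε ≤ |inner ℝ (u n) (normalizedDirection (channelOutput P p.1 s p.2)) -
      Real.sqrt (2 * β / (2 * β + Real.pi))|}) (fun s => ?_) fun s hs => ?_
  · have := measurable_channelOutput (n := n) P s
    exact measurableSet_le measurable_const (by fun_prop)
  · rw [← hs] at hkn hln ⊢
    exact measure_abs_inner_channelOutput_sub_ge_le hn1 hP (hu n hn1) hη0 hη hkn hln
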